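/- **Conventions.** An association scheme with $d$ classes on a finite set $X$ consists of nonempty relations $R_0,\dots,R_d$ partitioning $X\times X$ such that $R_0$ is the diagonal, every $R_i$ is symmetric, and for all $i,j,k$ the number of $z\in X$ with $(x,z)\in R_i$, $(z,y)\in R_j$ is the same for all $(x,y)\in R_k$. We say that graphs $G_1,\dots,G_d$ on $X$ form a $d$-class association scheme if the diagonal together with their adjacency relations does. A scheme is *amorphic* if for every partition $\Lambda_0=\{0\},\Lambda_1,\dots,\Lambda_{d'}$ of $\{0,\dots,d\}$ the relations $\bigcup_{k\in\Lambda_j}R_k$, $0\le j\le d'$, again form an association scheme. $\mathrm{Cay}(G,D)$ is the graph on $G$ in which $x,y$ are adjacent if and only if $x-y\in D$. **Theorem.** Let $q$ be a prime power, $n=2m$ an even positive integer, and $Q:V=\mathbb F_q^n\to\mathbb F_q$ a nonsingular quadratic form, i.e. with $B(u,v)=Q(u+v)-Q(u)-Q(v)$ the only $w\in V$ satisfying $Q(w)=0$ and $B(v,w)=0$ for all $v\in V$ is $w=0$. For $S\subseteq\mathbb F_q$ put $D_S=\{x\in V: Q(x)\in S\}$, and $D_0=D_{\{0\}}$. Let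 $e\mid q-1$, let $\gamma$ be a primitive element of $\mathbb F_{q^2}$, let $\omega=\mathrm{N}_{\mathbb F_{q^2}/\mathbb F_q}(\gamma)$, and let $C_i^{(e,q)}=\omega^i\langle\omega^e\rangle$ and $C_i^{(e,q^2)}=\gamma^i\langle\gamma^e\rangle$, $0\le i\le e-1$, be the cyclotomic classes of order $e$ of $\mathbb F_q$ and of $\mathbb F_{q^2}$. Let $A_1,\dots,A_d$ be a partition of $\{0,\dots,e-1\}$ into nonempty sets such that the graphs $\mathrm{Cay}\bigl(\mathbb F_{q^2},\bigcup_{\ell\in A_i}C_\ell^{(e,q^2)}\bigr)$, $1\le i\le d$, form an association scheme $\mathcal S$ (a fusion of the $e$-class cyclotomic scheme) on $\mathbb F_{q^2}$. Suppose $D_0\ne\{0\}$. Then the graphs $\mathrm{Cay}(V,D_0\setminus\{0\})$ and $\mathrm{Cay}\bigl(V,D_{\bigcup_{\ell\in A_i}C_\ell^{(e,q)}}\bigr)$, $1\le i\le d$, form a $(d+1)$-class association scheme on $V$, and this scheme is amorphic if $\mathcal S$ is amorphic. If $D_0=\{0\}$ (which can happen only for $n=2$), then the graph $\mathrm{Cay}(V,D_0\setminus\{0\})$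 has no edges, and the graphs $\mathrm{Cay}\bigl(V,D_{\bigcup_{\ell\in A_i}C_\ell^{(e,q)}}\bigr)$, $1\le i\le d$, form a $d$-class association scheme on $V$, which is amorphic if $\mathcal S$ is amorphic. -/

import Mathlib

/-- The indexed family `A` is a partition of the type `α` into nonempty parts. -/
def IsPartitionFamily {ι α : Type*} (A : ι → Set α) : Prop :=
  (∀ i, (A i).Nonempty) ∧ ∀ a, ∃! i, a ∈ A i

/-- `R 0, …, R d` form a (symmetric) association scheme with `d` classes on the finite set `X`. -/
structure IsAssociationScheme {X : Type*} {d : ℕ} (R : Fin (d + 1) → Set (X × X)) : Prop where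
  finite : Finite X
  partition : IsPartitionFamily R
  diagonal : R 0 = {p | p.1 = p.2}
  symmetric : ∀ i x y, (x, y) ∈ R i → (y, x) ∈ R i
  intersection : ∀ i j k, ∃ n : ℕ, ∀ x y, (x, y) ∈ R k →
    {z | (x, z) ∈ R i ∧ (z, y) ∈ R j}.ncard = n

/-- The relations `R_{Λ_j} = ⋃_{k ∈ Λ_j} R_k`. -/
def fuse {X : Type*} {d d' : ℕ} (R : Fin (d + 1) → Set (X × X))
    (Λ : Fin (d' + 1) → Set (Fin (d + 1))) : Fin (d' + 1) → Set (X × X) :=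
  fun j => ⋃ k ∈ Λ j, R k

/-- An association scheme is amorphic if each of its fusions, along any partition
`Λ_0 = {0}, Λ_1, …, Λ_{d'}` of the index set, is again an association scheme. -/
def IsAmorphic {X : Type*} {d : ℕ} (R : Fin (d + 1) → Set (X × X)) : Prop :=
  IsAssociationScheme R ∧
    ∀ (d' : ℕ) (Λ : Fin (d' + 1) → Set (Fin (d + 1))),
      IsPartitionFamily Λ → Λ 0 = {0} → IsAssociationScheme (fuse R Λ)

/-- The adjacency relation of the Cayley graph `Cay(G, D)`: two vertices are adjacent
if and only if their difference belongs to `D`. -/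
def cayleyRel {G : Type*} [AddGroup G] (D : Set G) : Set (G × G) :=
  {p | p.1 - p.2 ∈ D}

/-- The diagonal relation on `G` followed by the adjacency relations of
`Cay(G, D_1), …, Cay(G, D_d)`. -/
def cayleyRelations {G : Type*} [AddGroup G] {d : ℕ} (D : Fin d → Set G) :
    Fin (d + 1) → Set (G × G) :=
  Fin.cons {p | p.1 = p.2} (fun i => cayleyRel (D i))

/-- The cyclotomic class `g^i ⟨g^e⟩` of order `e`, as a subset of the field `F`. -/
def cyclotomicClass {F : Type*} [Field F] (g : Fˣ) (e i : ℕ) : Set F :=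
  {x | ∃ u ∈ Subgroup.zpowers (g ^ e), x = ((g ^ i * u : Fˣ) : F)}

/-- The union of the cyclotomic classes `g^l ⟨g^e⟩` over the indices `l` in `A`. -/
def cyclotomicUnion {F : Type*} [Field F] (g : Fˣ) (e : ℕ) (A : Set (Fin e)) : Set F :=
  ⋃ l ∈ A, cyclotomicClass g e (l : ℕ)

/-- The set `D_S = {x ∈ V | Q(x) ∈ S}`. -/
def quadricSet {K V : Type*} [Field K] [AddCommGroup V] [Module K V]
    (Q : QuadraticForm K V) (S : Set K) : Set V :=
  {x | Q x ∈ S}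

/-! Write q for the order of the base field. In even dimension a nonsingular form Q takes all
nonzero values equally often: the fibre over c has P + E[c = 0] elements. Fix w ≠ 0 and put t =
Q(w). Double counting over a pencil of quadrics shows that the number N of u with Q(u) = a and Q(w -
u) = b satisfies qN = E(r - 1) + |V|/q, where r is the number of roots β of a + (t + a - b)β + tβ².
This r depends on a, b, t alone; the form and the dimension enter only through E and |V|
(`HasValueCounts.card_mul_ncard_inter`). Summing over sets of values, the intersection numbers of
all such forms are affine functions of the same quantities `rootSum`.

The norm from 𝔽_{q²} to 𝔽_q is such a form, with E = -q ≠ 0, and the cyclotomic classes upstairs are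
the preimages of those downstairs (`cyclotomicUnion_eq_quadricSet`). So the scheme hypothesis makes
the root sums constant on the parts (`IsTranslationScheme.isRootScheme`), and this transfers to Q.
The only new class is D_0 \ {0}; its root sums are explicit because the quadratic factors when a =
0.

For amorphicity with D_0 ≠ {0}, a fusion may merge D_0 \ {0} with other classes, so constancy alone
is not enough. Each two-part fusion of the cyclotomic scheme is a strongly regular graph, and
character sums together with a divisibility argument force it to be of negative Latin square type
(`negativeLatinSquare_of_stronglyRegular`, `two_values_eq`). Hence the root sum of T with itself at
t is -|T| + (q - 2|T|)[t ∈ T]. Adjoining the value 0 to T keeps it affine in the indicator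
(`rootSum_biUnion_cons`), and polarization yields all mixed sums (`rootSum_const_of_fusions`). -/

/-! ### Value distribution of quadratic forms -/

/-- The number of preimages of `c` under `f` depends only on whether `c` is zero: it is
`P + E` for `c = 0` and `P` otherwise. -/
def HasValueCounts {X K : Type*} [Zero K] (f : X → K) (P E : ℤ) : Prop :=
  ∀ c, ((f ⁻¹' {c}).ncard : ℤ) = P + Set.indicator {0} (fun _ => E) c

theorem HasValueCounts.comp_equiv {X Y K : Type*} [Zero K] {f : X → K} {P E : ℤ}
    (h : HasValueCounts f P E) (φ : Y ≃ X) : HasValueCounts (f ∘ φ) P E := by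
  intro c
  rw [← h c, Set.preimage_comp, ← Set.ncard_image_of_injective _ φ.injective,
    Set.image_preimage_eq _ φ.surjective]

/-- A function whose value sets are permuted transitively on nonzero values. -/
theorem hasValueCounts_of_scaling {X K : Type*} [Field K] (f : X → K)
    (h : ∀ c : K, c ≠ 0 → ∃ φ : X ≃ X, ∀ x, f (φ x) = c * f x) :
    ∃ P E, HasValueCounts f P E := by
  refine ⟨(f ⁻¹' {1}).ncard, (f ⁻¹' {0}).ncard - (f ⁻¹' {1}).ncard, fun c => ?_⟩
  by_cases hc : c = 0
  · simp [hc]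
  · obtain ⟨φ, hφ⟩ := h c hc
    have : φ ⁻¹' (f ⁻¹' {c}) = f ⁻¹' {1} := by
      ext x
      simp [hφ, hc]
    rw [Set.indicator_of_notMem (by simpa using hc), ← this,
      ← Set.ncard_image_of_injective (φ ⁻¹' (f ⁻¹' {c})) φ.injective,
      Set.image_preimage_eq _ φ.surjective, add_zero]

/-- Functions of the form constant plus multiple of the delta at 0 are closed under convolution, and
the delta coefficients multiply. -/
theorem HasValueCounts.prod {X Y K : Type*} [Field K] [Finite K] [Finite X] [Finite Y]
    {f : X → K} {g : Y → K} {P E P' E' : ℤ}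
    (hf : HasValueCounts f P E) (hg : HasValueCounts g P' E') :
    HasValueCounts (fun z : X × Y => f z.1 + g z.2)
      (Nat.card K * P * P' + P * E' + E * P') (E * E') := by
  classical
  intro c
  have := Fintype.ofFinite K
  have := Fintype.ofFinite X
  have := Fintype.ofFinite Y
  have key : (((fun z : X × Y => f z.1 + g z.2) ⁻¹' {c}).ncard : ℤ) =
      ∑ a : K, ((f ⁻¹' {a}).ncard : ℤ) * ((g ⁻¹' {c - a}).ncard : ℤ) := by
    have h1 : ∀ a : K, ((f ⁻¹' {a}).ncard : ℤ) * ((g ⁻¹' {c - a}).ncard : ℤ) =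
        (({z : X × Y | f z.1 + g z.2 = c} ∩ {z | f z.1 = a}).ncard : ℤ) := by
      intro a
      rw [← Nat.cast_mul, ← Set.ncard_prod]
      congr 2
      ext ⟨x, y⟩
      simp only [Set.mem_prod, Set.mem_preimage, Set.mem_singleton_iff, Set.mem_inter_iff,
        Set.mem_ofPred_eq]
      constructor
      · rintro ⟨rfl, h⟩
        exact ⟨by rw [h]; ring, rfl⟩
      · rintro ⟨h, rfl⟩
        exact ⟨rfl, by rw [← h]; ring⟩
    simp_rw [h1, Set.ncard_eq_toFinset_card']
    rw [← Nat.cast_sum]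
    congr 1
    rw [Finset.card_eq_sum_card_fiberwise (f := fun z : X × Y => f z.1)
      (t := Finset.univ) (fun _ _ => by simp)]
    refine Finset.sum_congr rfl fun a _ => congrArg _ ?_
    ext z
    simp
  rw [key]
  simp_rw [hf _, hg _]
  have e : ∀ a : K, Set.indicator {0} (fun _ => E') (c - a) = if a = c then E' else 0 := by
    intro a
    simp [Set.indicator_apply, sub_eq_zero, eq_comm]
  simp_rw [e, add_mul, mul_add, Finset.sum_add_distrib, Set.indicator_apply]
  simp [Finset.sum_ite_eq', eq_comm]
  ring_nf

/-- Over a finite field of odd characteristic, `x² + d y²` with `d ≠ 0` represents every `c`. -/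
theorem exists_sq_add_mul_sq {K : Type*} [Field K] [Finite K] (hK : ringChar K ≠ 2)
    {d : K} (hd : d ≠ 0) (c : K) : ∃ u v : K, u ^ 2 + d * v ^ 2 = c := by
  have := Fintype.ofFinite K
  obtain ⟨u, v, h⟩ := FiniteField.exists_root_sum_quadratic
    (f := Polynomial.X ^ 2 - Polynomial.C c) (g := Polynomial.C d * Polynomial.X ^ 2)
    (Polynomial.degree_X_pow_sub_C (by norm_num) c) (Polynomial.degree_C_mul_X_pow 2 hd)
    (FiniteField.odd_card_of_char_ne_two hK)
  refine ⟨u, v, ?_⟩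
  simp at h
  linear_combination h

/-- Every c is a similitude factor: if c = u² + (b/a)v², then multiplication by u + v√(-b/a),
written in coordinates as `φ`, scales the form by c. -/
theorem hasValueCounts_binary {K : Type*} [Field K] [Finite K] (hK : ringChar K ≠ 2)
    {a b : K} (ha : a ≠ 0) (hb : b ≠ 0) :
    ∃ P E, HasValueCounts (fun z : K × K => a * z.1 ^ 2 + b * z.2 ^ 2) P E := by
  refine hasValueCounts_of_scaling _ fun c hc => ?_
  obtain ⟨u, v, huv⟩ := exists_sq_add_mul_sq hK (div_ne_zero hb ha) c
  have huv' : a * u ^ 2 + b * v ^ 2 = a * c := by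
    rw [← huv]; field_simp
  let φ : K × K → K × K := fun z => (u * z.1 - b / a * v * z.2, v * z.1 + u * z.2)
  have hinj : Function.Injective φ := by
    rintro ⟨x, y⟩ ⟨x', y'⟩ h
    simp only [φ, Prod.mk.injEq] at h
    obtain ⟨h1, h2⟩ := h
    have hx : c * (x - x') = 0 := by
      rw [← huv]; linear_combination u * h1 + b / a * v * h2
    have hy : c * (y - y') = 0 := by
      rw [← huv]; linear_combination u * h2 - v * h1
    simp only [mul_eq_zero, hc, false_or, sub_eq_zero] at hx hy
    rw [hx, hy]
  refine ⟨Equiv.ofBijective φ (Finite.injective_iff_bijective.mp hinj), fun z => ?_⟩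
  simp only [Equiv.ofBijective_apply, φ]
  rw [← huv]
  field_simp
  ring

theorem hasValueCounts_weightedSum {K : Type*} [Field K] [Finite K] (hK : ringChar K ≠ 2)
    (m : ℕ) (w : Fin (2 * m) → K) (hw : ∀ i, w i ≠ 0) :
    ∃ P E, HasValueCounts (fun v : Fin (2 * m) → K => ∑ i, w i * v i ^ 2) P E := by
  induction m with
  | zero =>
    refine ⟨0, 1, fun c => ?_⟩
    by_cases hc : c = 0
    · subst hc
      simp [Set.preimage, Set.ncard_univ]
    · simp [Set.preimage, hc, Ne.symm hc]
  | succ m ih =>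
    obtain ⟨P, E, h⟩ := ih (fun i => w i.succ.succ) fun i => hw _
    obtain ⟨P', E', h'⟩ := hasValueCounts_binary hK (hw 0) (hw (Fin.succ 0))
    have h2 := (h'.prod h).comp_equiv
      (((Fin.consEquiv fun _ : Fin (2 * m + 2) => K).symm.trans
        ((Equiv.refl K).prodCongr (Fin.consEquiv fun _ : Fin (2 * m + 1) => K).symm)).trans
        (Equiv.prodAssoc K K (Fin (2 * m) → K)).symm)
    refine ⟨_, _, fun c => Eq.trans
      (congrArg (fun f => ((f ⁻¹' {c}).ncard : ℤ)) ?_) (h2 c)⟩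
    funext v
    change ∑ i : Fin (2 * m + 1 + 1), w i * v i ^ 2 = _
    rw [Fin.sum_univ_succ, Fin.sum_univ_succ]
    simp [Fin.consEquiv, add_assoc, Fin.tail]

open QuadraticMap in
-- Diagonalize; the even dimension lets the squares be grouped into binary forms.
theorem hasValueCounts_of_ringChar_ne_two {K V : Type*} [Field K] [Finite K] [AddCommGroup V]
    [Module K V] [FiniteDimensional K V] (hK : ringChar K ≠ 2) {m : ℕ}
    (hV : Module.finrank K V = 2 * m)
    (Q : QuadraticForm K V) (hB : ∀ w, (∀ v, polar Q w v = 0) → w = 0) :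
    ∃ P E, HasValueCounts Q P E := by
  have h2 : (2 : K) ≠ 0 := Ring.two_ne_zero hK
  have : Invertible (2 : K) := invertibleOfNonzero h2
  have hsep : (associated (R := K) Q).SeparatingLeft := by
    intro w hw
    refine hB w fun v => ?_
    have := hw v
    rw [associated_apply] at this
    simpa [polar, h2] using this
  have hdiag := QuadraticForm.equivalent_weightedSumSquares_units_of_nondegenerate' Q hsep
  rw [hV] at hdiag
  obtain ⟨w, ⟨φ⟩⟩ := hdiag
  obtain ⟨P, E, h⟩ := hasValueCounts_weightedSum hK m (fun i => (w i : K)) fun i => (w i).ne_zero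
  refine ⟨P, E, fun c => Eq.trans (congrArg (fun f => ((f ⁻¹' {c}).ncard : ℤ)) ?_)
    (h.comp_equiv φ.toLinearEquiv.toEquiv c)⟩
  funext v
  have := φ.map_app v
  rw [weightedSumSquares_apply] at this
  rw [← this]
  refine Finset.sum_congr rfl fun i _ => ?_
  rw [Units.smul_def, smul_eq_mul, _root_.sq]
  rfl

/-! ### Nondegeneracy of the polar form, and value counts in every characteristic -/

/-- An alternating matrix of odd size over a commutative ring of characteristic two has zero
determinant. -/
theorem Matrix.det_eq_zero_of_alternating_of_odd {ι R : Type*} [Fintype ι] [DecidableEq ι]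
    [CommRing R] [CharP R 2] (M : Matrix ι ι R) (hsymm : ∀ i j, M i j = M j i)
    (hdiag : ∀ i, M i i = 0) (hodd : Odd (Fintype.card ι)) : M.det = 0 := by
  rw [Matrix.det_apply]
  -- The terms of σ and σ⁻¹ agree and cancel in characteristic two. If σ = σ⁻¹, then σ fixes a point
  -- because the size is odd, and its term contains a zero diagonal entry.
  refine Finset.sum_involution (fun σ _ => σ⁻¹) (fun σ _ => ?_) (fun σ _ h1 h2 => ?_) (by simp)
    (by simp)
  · have : ∏ i, M (σ⁻¹ i) i = ∏ i, M (σ i) i := by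
      rw [← Equiv.prod_comp σ]
      simp [hsymm]
    rw [this, Equiv.Perm.sign_inv]
    exact CharTwo.add_self_eq_zero _
  · refine h1 ?_
    have : Fact (Nat.Prime 2) := ⟨Nat.prime_two⟩
    obtain ⟨i, hi⟩ := Equiv.Perm.exists_fixed_point_of_prime (p := 2) (n := 1) (σ := σ)
      (fun h => (Nat.not_even_iff_odd.mpr hodd) (even_iff_two_dvd.mpr h))
      (by rw [pow_one, sq, mul_eq_one_iff_eq_inv, h2])
    rw [Finset.prod_eq_zero (Finset.mem_univ i) (by rw [hi, hdiag]), smul_zero]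


open QuadraticMap in
/-- A quadratic form with trivial radical on an even-dimensional space over a finite field has a
nondegenerate polar form. -/
theorem polar_nondegenerate_of_radical_eq_bot {K V : Type*} [Field K] [Finite K] [AddCommGroup V]
    [Module K V] [FiniteDimensional K V] {m : ℕ} (hV : Module.finrank K V = 2 * m)
    (Q : QuadraticForm K V) (hQ : Q.radical = ⊥) (w : V) (hw : ∀ v, polar Q w v = 0) : w = 0 := by
  have hrad : ∀ w, Q w = 0 → (∀ v, polar Q w v = 0) → w = 0 := by
    intro w h0 h1
    have : w ∈ Q.radical := mem_radical_iff'.mpr ⟨h0, fun v => by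
      have := h1 v
      rw [polar, h0, sub_zero, sub_eq_zero] at this
      exact this⟩
    rwa [hQ, Submodule.mem_bot] at this
  have hself : ∀ v, polar Q v v = 2 * Q v := fun v => by
    rw [polar_self, nsmul_eq_mul]; norm_num
  by_cases hK : ringChar K = 2
  · have : CharP K 2 := hK ▸ ringChar.charP K
    have halt : ∀ v, polar Q v v = 0 := fun v => by
      rw [hself, CharTwo.two_eq_zero, zero_mul]
    by_contra hne
    -- A complement W of the line of w has odd dimension, so the polar form restricted to W has a
    -- nonzero kernel vector x, which is then orthogonal to all of V.
    obtain ⟨W, hW⟩ := (K ∙ w).exists_isCompl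
    have hdim := Submodule.finrank_add_eq_of_isCompl hW
    rw [finrank_span_singleton hne, hV] at hdim
    let b := Module.finBasis K W
    have hdet := Matrix.det_eq_zero_of_alternating_of_odd
      (Matrix.of fun i j => polar Q (b i : V) (b j : V)) (fun i j => by simp [polar_comm])
      (fun i => halt _) (by rw [Fintype.card_fin]; exact ⟨m - 1, by omega⟩)
    obtain ⟨c, hc0, hc⟩ := Matrix.exists_mulVec_eq_zero_iff.mpr hdet
    let x : W := ∑ i, c i • b i
    have hx0 : x ≠ 0 := fun h => hc0 (funext fun i => by
      have := congrArg (fun y => b.repr y i) h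
      rwa [b.repr_sum_self, map_zero] at this)
    have hxb : ∀ j, polarBilin Q (b j : V) (x : V) = 0 := by
      intro j
      have := congrFun hc j
      simp only [Matrix.mulVec, dotProduct, Matrix.of_apply, Pi.zero_apply] at this
      rw [← this]
      simp [x, mul_comm]
    have hxW : ∀ y : W, polarBilin Q (y : V) (x : V) = 0 := by
      intro y
      rw [← b.sum_repr y]
      simp only [AddSubmonoidClass.coe_finsetSum, Submodule.coe_smul, map_sum, map_smul,
        LinearMap.sum_apply, LinearMap.smul_apply, hxb, smul_zero, Finset.sum_const_zero]
    have hxV : ∀ v, polar Q (x : V) v = 0 := by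
      intro v
      obtain ⟨y, hy, z, hz, rfl⟩ := Submodule.mem_sup.mp
        (hW.sup_eq_top ▸ Submodule.mem_top : v ∈ (K ∙ w) ⊔ W)
      obtain ⟨a, rfl⟩ := Submodule.mem_span_singleton.mp hy
      rw [polar_add_right, polar_smul_right, polar_comm Q (x : V) w, hw, polar_comm,
        ← polarBilin_apply_apply, hxW ⟨z, hz⟩]
      simp
    have hQw : Q w ≠ 0 := fun h => hne (hrad w h hw)
    have := Fintype.ofFinite K
    -- As every element is a square, x can be corrected by a multiple of w to a vector that is
    -- singular and orthogonal to V, hence zero. That puts x in the line of w, against the choice of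
    -- W.
    obtain ⟨r, hr⟩ := FiniteField.isSquare_of_char_two hK (Q (x : V) / Q w)
    have hxw : (x : V) + r • w = 0 := by
      refine hrad _ ?_ fun v => ?_
      · rw [QuadraticMap.map_add Q, polar_smul_right, hxV, QuadraticMap.map_smul, smul_zero,
          add_zero, ← hr, smul_eq_mul, div_mul_cancel₀ _ hQw]
        exact CharTwo.add_self_eq_zero _
      · rw [polar_add_left, polar_smul_left, hxV, hw, smul_zero, add_zero]
    have hmem : (x : V) ∈ K ∙ w := by
      rw [eq_neg_of_add_eq_zero_left hxw]
      exact Submodule.neg_mem _ (Submodule.smul_mem _ _ (Submodule.mem_span_singleton_self w))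
    exact hx0 (Subtype.ext (Submodule.disjoint_def.mp hW.disjoint _ hmem x.2))
  · refine hrad w ?_ hw
    simpa [hself, Ring.two_ne_zero hK] using hw w

open QuadraticMap in
/-- A nondegenerate quadratic form on an even-dimensional space over a finite field takes all
nonzero values equally often. -/
theorem exists_hasValueCounts {K V : Type*} [Field K] [Finite K] [AddCommGroup V]
    [Module K V] [FiniteDimensional K V] {m : ℕ} (hV : Module.finrank K V = 2 * m)
    (Q : QuadraticForm K V) (hB : ∀ w, (∀ v, polar Q w v = 0) → w = 0) :
    ∃ P E, HasValueCounts Q P E := by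
  by_cases hK : ringChar K = 2
  · have := Fintype.ofFinite K
    refine hasValueCounts_of_scaling _ fun c hc => ?_
    -- Every c is a square r², so scalar multiplication by r is already a similitude with factor c.
    obtain ⟨r, rfl⟩ := FiniteField.isSquare_of_char_two hK c
    have hr : r ≠ 0 := fun h => hc (by simp [h])
    refine ⟨(LinearEquiv.smulOfNeZero K V r hr).toEquiv, fun x => ?_⟩
    exact Q.map_smul r x
  · exact hasValueCounts_of_ringChar_ne_two hK hV Q hB

/-! ### Counting u with prescribed Q(u) and Q(w - u) -/

theorem Set.ncard_eq_sum_indicator {X : Type*} [Fintype X] (S : Set X) :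
    (S.ncard : ℤ) = ∑ x, S.indicator 1 x := by
  classical
  rw [Set.ncard_eq_toFinset_card']
  simp [Set.indicator_apply]

theorem LinearMap.card_mul_ncard_fiber {K V : Type*} [Field K] [Finite K] [AddCommGroup V]
    [Module K V] [Finite V] (f : V →ₗ[K] K) (hf : f ≠ 0) (s : K) :
    (Nat.card K : ℤ) * ({u | f u = s}.ncard : ℤ) = Nat.card V := by
  classical
  have := Fintype.ofFinite K
  have := Fintype.ofFinite V
  have hsurj := LinearMap.surjective hf
  have hconst : ∀ r, {u | f u = r}.ncard = {u | f u = s}.ncard := by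
    intro r
    obtain ⟨v, hv⟩ := hsurj (s - r)
    rw [← Set.ncard_image_of_injective _ (add_left_injective v)]
    congr 1
    ext u
    simp only [Set.mem_image, Set.mem_ofPred_eq]
    constructor
    · rintro ⟨x, rfl, rfl⟩
      simp [hv]
    · intro h
      exact ⟨u - v, by simp [h, hv], by simp⟩
  have hsum : ∑ r : K, {u | f u = r}.ncard = Fintype.card V := by
    simp_rw [Set.ncard_eq_toFinset_card']
    rw [← Finset.card_univ,
      Finset.card_eq_sum_card_fiberwise (f := f) (t := Finset.univ) (fun _ _ => by simp)]
    refine Finset.sum_congr rfl fun a _ => congrArg _ ?_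
    ext z
    simp
  simp_rw [hconst] at hsum
  rw [Finset.sum_const, Finset.card_univ, smul_eq_mul] at hsum
  rw [Nat.card_eq_fintype_card, Nat.card_eq_fintype_card]
  exact_mod_cast hsum

/-- The number of roots of the polynomial `a + (t + a - b) X + t X²`. -/
noncomputable def rootCount {K : Type*} [Field K] (a b t : K) : ℤ :=
  ({β : K | a + (t + a - b) * β + t * β ^ 2 = 0}.ncard : ℤ)

theorem HasValueCounts.card_eq {X K : Type*} [Field K] [Finite K] [Finite X] {f : X → K} {P E : ℤ}
    (h : HasValueCounts f P E) : (Nat.card X : ℤ) = Nat.card K * P + E := by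
  classical
  have := Fintype.ofFinite K
  have := Fintype.ofFinite X
  have hsum : ∑ c : K, ((f ⁻¹' {c}).ncard : ℤ) = Fintype.card X := by
    simp_rw [Set.ncard_eq_toFinset_card']
    rw [← Finset.card_univ, ← Nat.cast_sum,
      Finset.card_eq_sum_card_fiberwise (f := f) (t := Finset.univ) (fun _ _ => by simp)]
    refine congrArg _ (Finset.sum_congr rfl fun a _ => congrArg _ ?_)
    ext z
    simp
  rw [Nat.card_eq_fintype_card, ← hsum, Nat.card_eq_fintype_card]
  simp_rw [h _, Finset.sum_add_distrib, Set.indicator_apply]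
  simp

/-- The extra indicator plays the role of β = ∞: a pencil through (x, y) has exactly one member
vanishing there, unless x = y = 0, when all q + 1 vanish. -/
theorem sum_pencil {K : Type*} [Field K] [Fintype K] (x y : K) :
    ∑ β : K, Set.indicator {β | x + β * y = 0} (1 : K → ℤ) β + Set.indicator {0} 1 y =
      1 + Fintype.card K * (Set.indicator {0} 1 x * Set.indicator {0} 1 y) := by
  rw [← Set.ncard_eq_sum_indicator]
  by_cases hy : y = 0
  · by_cases hx : x = 0
    · simp [hx, hy, Set.ncard_univ, Nat.card_eq_fintype_card]
      ring
    · simp [hx, hy]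
  · have : {β | x + β * y = 0} = {-x / y} := by
      ext β
      simp only [Set.mem_ofPred_eq, Set.mem_singleton_iff]
      rw [eq_div_iff hy]
      constructor <;> intro h <;> linear_combination h
    simp [this, hy]

open QuadraticMap in
-- Given Q(u) = a, the condition Q(w - u) = b is linear in u: B(w, u) = s with s = Q(w) + a - b. The
-- pairs (β, u) with (Q(u) - a) + β(B(w, u) - s) = 0 are counted by rows and by columns.
theorem HasValueCounts.card_mul_ncard_inter {K V : Type*} [Field K] [Finite K] [AddCommGroup V]
    [Module K V] [Finite V] {Q : QuadraticForm K V} {P E H : ℤ} (hQ : HasValueCounts Q P E)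
    (hB : ∀ w, (∀ v, polar Q w v = 0) → w = 0) (hH : (Nat.card K : ℤ) * H = Nat.card V)
    {w : V} (hw : w ≠ 0) (a b : K) :
    (Nat.card K : ℤ) * ({u | Q u = a ∧ Q (w - u) = b}.ncard : ℤ) =
      E * (rootCount a b (Q w) - 1) + H := by
  classical
  have := Fintype.ofFinite K
  have := Fintype.ofFinite V
  obtain ⟨s, hs⟩ : ∃ s, s = Q w + a - b := ⟨_, rfl⟩
  have hset : {u | Q u = a ∧ Q (w - u) = b} = {u | Q u = a ∧ polar Q w u = s} := by
    ext u
    have : Q (w - u) = Q w + Q u - polar Q w u := by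
      rw [sub_eq_add_neg, QuadraticMap.map_add Q, polar_neg_right, QuadraticMap.map_neg]
      ring
    simp only [Set.mem_ofPred_eq, this, hs]
    refine and_congr_right fun h => ?_
    rw [h]
    constructor <;> intro h' <;> linear_combination -h'
  have hf : polarBilin Q w ≠ 0 := fun h => hw (hB w fun v => by
    rw [← polarBilin_apply_apply, h, LinearMap.zero_apply])
  have hfib : ({u | polar Q w u = s}.ncard : ℤ) = H := by
    have h1 := (polarBilin Q w).card_mul_ncard_fiber hf s
    rw [← hH] at h1
    refine mul_left_cancel₀ ?_ h1
    exact_mod_cast Nat.card_pos.ne'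
  -- Translation by βw completes the square, so each member of the pencil becomes a level set of Q.
  have hslice : ∀ β : K, ({u | (Q u - a) + β * (polar Q w u - s) = 0}.ncard : ℤ) =
      P + Set.indicator {0} (fun _ => E) (a + s * β + Q w * β ^ 2) := by
    intro β
    rw [← hQ, ← Set.ncard_image_of_injective _ (add_left_injective (β • w))]
    congr 2
    ext u
    simp only [Set.mem_image, Set.mem_ofPred_eq, Set.mem_preimage, Set.mem_singleton_iff]
    have hv : ∀ v : V, Q (v + β • w) = Q v + β ^ 2 * Q w + β * polar Q w v := by
      intro v
      rw [QuadraticMap.map_add Q, QuadraticMap.map_smul, polar_smul_right, polar_comm Q v w]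
      simp only [smul_eq_mul]
      ring
    constructor
    · rintro ⟨v, h, rfl⟩
      rw [hv]
      linear_combination h
    · intro h
      refine ⟨u - β • w, ?_, by simp⟩
      rw [← sub_add_cancel u (β • w), hv] at h
      linear_combination h
  have hcount := hQ.card_eq
  have hroot : (rootCount a b (Q w)) * E =
      ∑ β : K, Set.indicator {0} (fun _ => E) (a + s * β + Q w * β ^ 2) := by
    rw [rootCount, Set.ncard_eq_sum_indicator, Finset.sum_mul, ← hs]
    refine Finset.sum_congr rfl fun β _ => ?_
    simp [Set.indicator_apply]
  have hdouble : ∑ β : K, ({u | (Q u - a) + β * (polar Q w u - s) = 0}.ncard : ℤ) +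
      ({u | polar Q w u = s}.ncard : ℤ) = Fintype.card V +
        Fintype.card K * ({u | Q u = a ∧ polar Q w u = s}.ncard : ℤ) := by
    simp_rw [Set.ncard_eq_sum_indicator]
    rw [Finset.sum_comm, Finset.mul_sum, ← Finset.sum_add_distrib, Fintype.card_eq_sum_ones,
      Nat.cast_sum, ← Finset.sum_add_distrib]
    refine Finset.sum_congr rfl fun u _ => ?_
    have := sum_pencil (Q u - a) (polar Q w u - s)
    simp only [Set.indicator_apply, Set.mem_ofPred_eq, Set.mem_singleton_iff, sub_eq_zero,
      Pi.one_apply, ite_and, mul_ite, mul_one, mul_zero,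
      Nat.cast_one] at this ⊢
    rw [this]
    split_ifs <;> rfl
  simp_rw [hslice, Finset.sum_add_distrib, ← hroot, hfib] at hdouble
  rw [hset]
  simp only [Finset.sum_const, Finset.card_univ, nsmul_eq_mul, Nat.card_eq_fintype_card]
    at hdouble hcount ⊢
  linear_combination -hdouble - hcount

/-- The bilinear sum of `rootCount a b t - 1` over all `a`, `b`, with weights `f a` and `g b`. -/
noncomputable def rootSum {K : Type*} [Field K] [Fintype K] (f g : K → ℤ) (t : K) : ℤ :=
  ∑ a, ∑ b, f a * g b * (rootCount a b t - 1)

open QuadraticMap in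
theorem HasValueCounts.card_mul_ncard_pairs {K V : Type*} [Field K] [Fintype K] [AddCommGroup V]
    [Module K V] [Finite V] {Q : QuadraticForm K V} {P E H : ℤ} (hQ : HasValueCounts Q P E)
    (hB : ∀ w, (∀ v, polar Q w v = 0) → w = 0) (hH : (Nat.card K : ℤ) * H = Nat.card V)
    {w : V} (hw : w ≠ 0) (S T : Set K) :
    (Nat.card K : ℤ) * ({u | Q u ∈ S ∧ Q (w - u) ∈ T}.ncard : ℤ) =
      E * rootSum (S.indicator 1) (T.indicator 1) (Q w) + H * S.ncard * T.ncard := by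
  classical
  have := Fintype.ofFinite V
  have key : ({u | Q u ∈ S ∧ Q (w - u) ∈ T}.ncard : ℤ) =
      ∑ a, ∑ b, S.indicator 1 a * T.indicator 1 b *
        ({u | Q u = a ∧ Q (w - u) = b}.ncard : ℤ) := by
    simp_rw [Set.ncard_eq_sum_indicator, Finset.mul_sum]
    rw [Finset.sum_congr rfl fun a _ => Finset.sum_comm, Finset.sum_comm]
    refine Finset.sum_congr rfl fun u _ => ?_
    rw [Finset.sum_eq_single (Q u), Finset.sum_eq_single (Q (w - u))]
    · by_cases h1 : Q u ∈ S <;> by_cases h2 : Q (w - u) ∈ T <;> simp [h1, h2]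
    · intro b _ hb
      simp [Ne.symm hb]
    · simp
    · intro a _ ha
      simp [Ne.symm ha]
    · simp
  have hprod : H * S.ncard * T.ncard =
      ∑ a, ∑ b, H * (S.indicator 1 a * T.indicator 1 b) := by
    simp_rw [← Finset.mul_sum, ← Finset.sum_mul, Set.ncard_eq_sum_indicator, mul_assoc]
  rw [key, rootSum, hprod]
  simp_rw [Finset.mul_sum, ← Finset.sum_add_distrib]
  refine Finset.sum_congr rfl fun a _ => Finset.sum_congr rfl fun b _ => ?_
  linear_combination (S.indicator 1 a * T.indicator 1 b) * hQ.card_mul_ncard_inter hB hH hw a b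

/-! ### Evaluation of root counts and root sums -/

section rootSum

variable {K : Type*} [Field K]

/-- The substitution β ↦ -1 - β exchanges a and b. -/
theorem rootCount_comm (a b t : K) : rootCount a b t = rootCount b a t := by
  rw [rootCount, ← Set.ncard_image_of_injective (f := fun β : K => -1 - β) _
    (fun x y h => by simpa using h), rootCount]
  congr 2
  ext β
  simp only [Set.mem_image, Set.mem_ofPred_eq]
  constructor
  · rintro ⟨x, h, rfl⟩
    linear_combination h
  · intro h
    exact ⟨-1 - β, by linear_combination h, by ring⟩

/-- The polynomial factors as β(tβ + t - b); its two roots coincide exactly when b = t. -/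
theorem rootCount_zero_left (b : K) {t : K} (ht : t ≠ 0) :
    rootCount 0 b t = 2 - Set.indicator {t} 1 b := by
  have : {β : K | 0 + (t + 0 - b) * β + t * β ^ 2 = 0} = {0, (b - t) / t} := by
    ext β
    simp only [Set.mem_ofPred_eq, Set.mem_insert_iff, Set.mem_singleton_iff]
    rw [eq_div_iff ht, ← sub_eq_zero (a := β * t), ← mul_eq_zero]
    constructor <;> intro h <;> linear_combination h
  rw [rootCount, this]
  by_cases hb : b = t
  · simp [hb]
  · rw [Set.ncard_pair (Ne.symm (div_ne_zero (sub_ne_zero.mpr hb) ht))]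
    simp [hb]

theorem rootCount_zero_zero_zero [Fintype K] : rootCount (0 : K) 0 0 = Fintype.card K := by
  simp [rootCount, Set.ncard_univ, Nat.card_eq_fintype_card]

theorem rootCount_right_zero {a b : K} (h : a ≠ 0 ∨ b ≠ 0) :
    rootCount a b 0 = 1 - Set.indicator {a} 1 b := by
  by_cases hb : b = a
  · have ha : a ≠ 0 := by simpa [hb] using h
    simp [rootCount, hb, ha]
  · have : {β : K | a + (0 + a - b) * β + 0 * β ^ 2 = 0} = {a / (b - a)} := by
      ext β
      simp only [Set.mem_ofPred_eq, Set.mem_singleton_iff]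
      rw [eq_div_iff (sub_ne_zero.mpr hb)]
      constructor <;> intro h <;> linear_combination -h
    rw [rootCount, this]
    simp [hb]

variable [Fintype K]

theorem rootSum_comm (f g : K → ℤ) (t : K) : rootSum f g t = rootSum g f t := by
  rw [rootSum, Finset.sum_comm, rootSum]
  refine Finset.sum_congr rfl fun a _ => Finset.sum_congr rfl fun b _ => ?_
  rw [rootCount_comm, mul_comm (f b)]

theorem rootSum_add_left (f f' g : K → ℤ) (t : K) :
    rootSum (f + f') g t = rootSum f g t + rootSum f' g t := by
  simp_rw [rootSum, ← Finset.sum_add_distrib, Pi.add_apply]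
  refine Finset.sum_congr rfl fun a _ => Finset.sum_congr rfl fun b _ => ?_
  ring

theorem rootSum_add_right (f g g' : K → ℤ) (t : K) :
    rootSum f (g + g') t = rootSum f g t + rootSum f g' t := by
  rw [rootSum_comm, rootSum_add_left, rootSum_comm g, rootSum_comm g']

theorem rootSum_zero_singleton (g : K → ℤ) (t : K) :
    rootSum (Set.indicator {0} 1) g t = ∑ b, g b * (rootCount 0 b t - 1) := by
  classical
  rw [rootSum, Finset.sum_eq_single 0]
  · simp
  · intro a _ ha
    simp [ha]
  · simp

theorem rootSum_zero_singleton_of_ne (T : Set K) {t : K} (ht : t ≠ 0) :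
    rootSum (Set.indicator {0} 1) (T.indicator 1) t = T.ncard - T.indicator 1 t := by
  classical
  rw [rootSum_zero_singleton, Set.ncard_eq_sum_indicator]
  have : ∀ b : K, T.indicator (1 : K → ℤ) b * (rootCount 0 b t - 1) =
      T.indicator 1 b - if b = t then T.indicator 1 b else 0 := by
    intro b
    rw [rootCount_zero_left b ht]
    by_cases hb : b = t
    · simp [hb]
    · simp only [Set.mem_singleton_iff, hb, not_false_eq_true, Set.indicator_of_notMem, if_false]
      ring
  simp_rw [this, Finset.sum_sub_distrib, Finset.sum_ite_eq', Finset.mem_univ, if_true]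

theorem rootSum_zero_singleton_zero {T : Set K} (hT : 0 ∉ T) :
    rootSum (Set.indicator {0} 1) (T.indicator 1) (0 : K) = 0 := by
  rw [rootSum_zero_singleton]
  refine Finset.sum_eq_zero fun b _ => ?_
  by_cases hb : b = 0
  · simp [hb, hT]
  · rw [rootCount_right_zero (Or.inr hb)]
    simp [hb]

theorem rootSum_zero_zero_zero :
    rootSum (Set.indicator {0} 1) (Set.indicator {0} 1) (0 : K) = Fintype.card K - 1 := by
  classical
  rw [rootSum_zero_singleton, Finset.sum_eq_single 0]
  · simp [rootCount_zero_zero_zero]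
  · intro a _ ha
    simp [ha]
  · simp

/-- At t = 0 the equation is linear, with one root if a ≠ b and none if a = b ≠ 0, so only the
diagonal contributes, with -1 each. -/
theorem rootSum_self_zero {T : Set K} (hT : 0 ∉ T) :
    rootSum (T.indicator 1) (T.indicator 1) (0 : K) = -T.ncard := by
  classical
  rw [Set.ncard_eq_sum_indicator, rootSum, ← Finset.sum_neg_distrib]
  refine Finset.sum_congr rfl fun a _ => ?_
  by_cases ha : a ∈ T
  · have ha0 : a ≠ 0 := fun h => hT (h ▸ ha)
    rw [Finset.sum_eq_single a]
    · rw [rootCount_right_zero (Or.inl ha0)]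
      simp [ha]
    · intro b _ hb
      rw [rootCount_right_zero (Or.inl ha0)]
      simp [hb]
    · simp
  · simp [ha]

end rootSum

/-! ### The norm of a quadratic extension as a quadratic form -/

section NormForm

variable (K L : Type*) [Field K] [Field L] [Algebra K L]

theorem algebraMap_norm_eq_mul_frobenius [Fintype K] [Finite L] (hL : Module.finrank K L = 2)
    (x : L) :
    algebraMap K L (Algebra.norm K x) = x * FiniteField.frobeniusAlgHom K L x := by
  rw [FiniteField.algebraMap_norm_eq_prod_pow, hL]
  simp [Finset.prod_range_succ]

theorem algebraMap_polar_norm [Fintype K] [Finite L] (hL : Module.finrank K L = 2) (x y : L) :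
    algebraMap K L (QuadraticMap.polar (fun x : L => Algebra.norm K x) x y) =
      x * FiniteField.frobeniusAlgHom K L y + y * FiniteField.frobeniusAlgHom K L x := by
  simp only [QuadraticMap.polar, map_sub, algebraMap_norm_eq_mul_frobenius K L hL, map_add]
  ring

variable [Finite K]

variable {K L} in
theorem finite_of_finrank_eq_two (hL : Module.finrank K L = 2) : Finite L := by
  have : Module.Finite K L := Module.finite_of_finrank_pos (by omega)
  exact Module.finite_of_finite K

/-- The norm of a quadratic extension of finite fields, as a quadratic form. -/
noncomputable def normForm (hL : Module.finrank K L = 2) : QuadraticForm K L :=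
  QuadraticMap.ofPolar (fun x => Algebra.norm K x)
    (fun a x => by
      rw [Algebra.smul_def, map_mul, Algebra.norm_algebraMap, hL, smul_eq_mul, sq])
    (fun x y z => by
      have := Fintype.ofFinite K
      have := finite_of_finrank_eq_two hL
      refine (algebraMap K L).injective ?_
      rw [map_add]
      simp only [algebraMap_polar_norm K L hL, map_add]
      ring)
    (fun a x y => by
      have := Fintype.ofFinite K
      have := finite_of_finrank_eq_two hL
      refine (algebraMap K L).injective ?_
      rw [smul_eq_mul, map_mul]
      rw [algebraMap_polar_norm K L hL, algebraMap_polar_norm K L hL, map_smul, Algebra.smul_def,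
        Algebra.smul_def]
      ring)

variable {K L} (hL : Module.finrank K L = 2)

@[simp]
theorem normForm_apply (x : L) : normForm K L hL x = Algebra.norm K x := rfl

theorem normForm_anisotropic : (normForm K L hL).Anisotropic := by
  have := finite_of_finrank_eq_two hL
  intro x hx
  exact Algebra.norm_eq_zero_iff.mp hx

theorem natCard_of_finrank_eq_two {K L : Type*} [Field K] [Finite K] [Field L] [Algebra K L]
    (hL : Module.finrank K L = 2) : Nat.card L = Nat.card K ^ 2 := by
  have : Module.Finite K L := Module.finite_of_finrank_pos (by omega)
  rw [← hL, Module.natCard_eq_pow_finrank (K := K)]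

theorem polar_normForm_nondegenerate (w : L)
    (hw : ∀ v, QuadraticMap.polar (normForm K L hL) w v = 0) : w = 0 := by
  have : Module.Finite K L := Module.finite_of_finrank_pos (by omega)
  refine polar_nondegenerate_of_radical_eq_bot (m := 1) hL (normForm K L hL) ?_ w hw
  rw [eq_bot_iff]
  intro x hx
  exact normForm_anisotropic hL x (QuadraticMap.mem_radical_iff'.mp hx).1

/-- The constants follow from P + E = 1, by anisotropy, and qP + E = q². -/
theorem hasValueCounts_normForm :
    HasValueCounts (normForm K L hL) (Nat.card K + 1) (-Nat.card K) := by
  have := finite_of_finrank_eq_two hL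
  have : Module.Finite K L := Module.finite_of_finrank_pos (by omega)
  obtain ⟨P, E, h⟩ := exists_hasValueCounts (m := 1) hL (normForm K L hL)
    (polar_normForm_nondegenerate hL)
  have h0 : (normForm K L hL) ⁻¹' {0} = {0} := by
    ext x
    exact ⟨fun hx => normForm_anisotropic hL x hx, fun hx => by simp [Set.mem_singleton_iff.mp hx]⟩
  have h1 := h 0
  have h2 := h.card_eq
  rw [natCard_of_finrank_eq_two hL] at h2
  rw [h0, Set.ncard_singleton] at h1
  simp only [Set.mem_singleton_iff, Set.indicator_of_mem] at h1
  push_cast at h1 h2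
  have hq : (1 : ℤ) < Nat.card K := by exact_mod_cast Finite.one_lt_card
  have hP : P = Nat.card K + 1 := by
    refine mul_left_cancel₀ (sub_ne_zero.mpr hq.ne') ?_
    linear_combination h1 - h2
  have hE : E = -Nat.card K := by linear_combination -h1 - hP
  rw [← hP, ← hE]
  exact h

theorem ncard_normForm_pairs {K L : Type*} [Field K] [Fintype K] [Field L] [Algebra K L]
    (hL : Module.finrank K L = 2) {w : L} (hw : w ≠ 0) (S T : Set K) :
    ({u | normForm K L hL u ∈ S ∧ normForm K L hL (w - u) ∈ T}.ncard : ℤ) =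
      S.ncard * T.ncard - rootSum (S.indicator 1) (T.indicator 1) (normForm K L hL w) := by
  have := finite_of_finrank_eq_two hL
  have h := (hasValueCounts_normForm hL).card_mul_ncard_pairs (polar_normForm_nondegenerate hL)
    (H := Nat.card K) (by rw [natCard_of_finrank_eq_two hL]; push_cast; ring) hw S T
  have hq : (Nat.card K : ℤ) ≠ 0 := by exact_mod_cast Nat.card_pos.ne'
  refine mul_left_cancel₀ hq ?_
  rw [h]
  ring

theorem ncard_preimage_normForm {K L : Type*} [Field K] [Fintype K] [Field L] [Algebra K L]
    (hL : Module.finrank K L = 2) {T : Set K} (hT : 0 ∉ T) :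
    ((quadricSet (normForm K L hL) T).ncard : ℤ) = (Fintype.card K + 1) * T.ncard := by
  classical
  have := finite_of_finrank_eq_two hL
  have := Fintype.ofFinite L
  rw [Set.ncard_eq_sum_indicator, Set.ncard_eq_sum_indicator,
    ← Finset.sum_fiberwise (g := normForm K L hL), Finset.mul_sum]
  refine Finset.sum_congr rfl fun a _ => ?_
  have h1 : ∀ x ∈ ({x | normForm K L hL x = a} : Finset L),
      (quadricSet (normForm K L hL) T).indicator (1 : L → ℤ) x = T.indicator 1 a := by
    intro x hx
    simp only [Finset.mem_filter, Finset.mem_univ, true_and] at hx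
    simp [quadricSet, Set.indicator_apply, ← hx]
  rw [Finset.sum_congr rfl h1, Finset.sum_const, nsmul_eq_mul]
  by_cases ha : a ∈ T
  · have ha0 : a ≠ 0 := fun h => hT (h ▸ ha)
    have h2 := hasValueCounts_normForm hL a
    rw [Set.ncard_eq_toFinset_card'] at h2
    simp only [Set.mem_singleton_iff, ha0, not_false_eq_true, Set.indicator_of_notMem, add_zero,
      Nat.card_eq_fintype_card] at h2
    rw [← h2]
    congr 3
    ext x
    simp only [Finset.mem_filter, Finset.mem_univ, true_and, Set.mem_toFinset, Set.mem_preimage,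
      Set.mem_singleton_iff]
  · simp [ha]

end NormForm

/-! ### Translation schemes: association schemes of Cayley graphs -/

section Cayley

variable {G : Type*} [AddCommGroup G] {d : ℕ}

/-- The conditions on the connection sets `D 0, …, D (d - 1)` under which their Cayley graphs form
an association scheme. -/
structure IsTranslationScheme (D : Fin d → Set G) : Prop where
  nonempty : ∀ i, (D i).Nonempty
  zero_notMem : ∀ i, 0 ∉ D i
  exists_unique : ∀ x, x ≠ 0 → ∃! i, x ∈ D i
  neg_mem : ∀ i x, x ∈ D i → -x ∈ D i
  count : ∀ i j k, ∃ n : ℕ, ∀ w ∈ D k, {u | u ∈ D i ∧ w - u ∈ D j}.ncard = n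

theorem mem_cayleyRelations_zero (D : Fin d → Set G) (x y : G) :
    (x, y) ∈ cayleyRelations D 0 ↔ x = y := Iff.rfl

theorem mem_cayleyRelations_succ (D : Fin d → Set G) (i : Fin d) (x y : G) :
    (x, y) ∈ cayleyRelations D i.succ ↔ x - y ∈ D i := Iff.rfl

theorem ncard_cayley_triangles (D E : Set G) (x y : G) :
    {z | x - z ∈ D ∧ z - y ∈ E}.ncard = {u | u ∈ D ∧ (x - y) - u ∈ E}.ncard := by
  rw [← Set.ncard_image_of_injective (f := fun z => x - z) _ (sub_right_injective)]
  congr 1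
  ext u
  simp only [Set.mem_image, Set.mem_ofPred_eq]
  constructor
  · rintro ⟨z, ⟨h1, h2⟩, rfl⟩
    exact ⟨h1, by simpa using h2⟩
  · rintro ⟨h1, h2⟩
    exact ⟨x - u, ⟨by simpa using h1, by rwa [sub_right_comm]⟩, by simp⟩

/-- By translation invariance only differences matter. Intersection numbers involving the diagonal
relation are automatic, so only nonzero differences need a condition. -/
theorem isAssociationScheme_cayleyRelations_iff [Finite G] (D : Fin d → Set G) :
    IsAssociationScheme (cayleyRelations D) ↔ IsTranslationScheme D := by
  constructor
  · intro h
    have hz : ∀ i, (0 : G) ∉ D i := fun i hi => by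
      have h0 : ((0 : G), (0 : G)) ∈ cayleyRelations D 0 := rfl
      have h1 : ((0 : G), (0 : G)) ∈ cayleyRelations D i.succ := by
        rw [mem_cayleyRelations_succ, sub_zero]
        exact hi
      exact Fin.succ_ne_zero i ((h.partition.2 _).unique h1 h0)
    refine ⟨fun i => ?_, hz, fun x hx => ?_, fun i x hx => ?_, fun i j k => ?_⟩
    · obtain ⟨⟨x, y⟩, hxy⟩ := h.partition.1 i.succ
      exact ⟨x - y, hxy⟩
    · obtain ⟨i, hi, huniq⟩ := h.partition.2 (x, 0)
      cases i using Fin.cases with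
      | zero => exact absurd hi hx
      | succ i =>
        rw [mem_cayleyRelations_succ, sub_zero] at hi
        refine ⟨i, hi, fun j hj => Fin.succ_injective _ (huniq j.succ ?_)⟩
        beta_reduce
        rw [mem_cayleyRelations_succ, sub_zero]
        exact hj
    · have := h.symmetric i.succ x 0 (by rwa [mem_cayleyRelations_succ, sub_zero])
      rwa [mem_cayleyRelations_succ, zero_sub] at this
    · obtain ⟨n, hn⟩ := h.intersection i.succ j.succ k.succ
      refine ⟨n, fun w hw => ?_⟩
      rw [← hn w 0 (by rwa [mem_cayleyRelations_succ, sub_zero])]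
      simp_rw [mem_cayleyRelations_succ]
      rw [ncard_cayley_triangles, sub_zero]
  · intro h
    have hpart : ∀ p : G × G, ∃! i, p ∈ cayleyRelations D i := by
      rintro ⟨x, y⟩
      by_cases hxy : x = y
      · refine ⟨0, hxy, fun j hj => ?_⟩
        cases j using Fin.cases with
        | zero => rfl
        | succ j =>
          rw [mem_cayleyRelations_succ, hxy, sub_self] at hj
          exact absurd hj (h.zero_notMem j)
      · obtain ⟨i, hi, huniq⟩ := h.exists_unique (x - y) (sub_ne_zero.mpr hxy)
        refine ⟨i.succ, hi, fun j hj => ?_⟩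
        cases j using Fin.cases with
        | zero => exact absurd hj hxy
        | succ j => exact congrArg _ (huniq j hj)
    refine ⟨inferInstance, ⟨fun i => ?_, hpart⟩, rfl, fun i x y hxy => ?_, fun i j k => ?_⟩
    · cases i using Fin.cases with
      | zero => exact ⟨(0, 0), rfl⟩
      | succ i =>
        obtain ⟨x, hx⟩ := h.nonempty i
        exact ⟨(x, 0), by rwa [mem_cayleyRelations_succ, sub_zero]⟩
    · cases i using Fin.cases with
      | zero => exact hxy.symm
      | succ i =>
        rw [mem_cayleyRelations_succ, ← neg_sub]
        exact h.neg_mem i _ hxy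
    · cases i using Fin.cases with
      | zero =>
        refine ⟨if j = k then 1 else 0, fun x y hxy => ?_⟩
        simp_rw [mem_cayleyRelations_zero]
        split_ifs with hjk
        · rw [Set.ncard_eq_one]
          exact ⟨x, Set.ext fun z => ⟨fun hz => hz.1.symm, fun hz => by
            rw [Set.mem_singleton_iff] at hz
            subst hz
            exact ⟨rfl, hjk ▸ hxy⟩⟩⟩
        · rw [Set.ncard_eq_zero]
          refine Set.eq_empty_of_forall_notMem ?_
          rintro z ⟨rfl, hz⟩
          exact hjk ((hpart _).unique hz hxy)
      | succ i =>
        cases j using Fin.cases with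
        | zero =>
          refine ⟨if i.succ = k then 1 else 0, fun x y hxy => ?_⟩
          simp_rw [mem_cayleyRelations_zero]
          split_ifs with hik
          · rw [Set.ncard_eq_one]
            exact ⟨y, Set.ext fun z => ⟨fun hz => hz.2, fun hz => by
              rw [Set.mem_singleton_iff] at hz
              subst hz
              exact ⟨hik ▸ hxy, rfl⟩⟩⟩
          · rw [Set.ncard_eq_zero]
            refine Set.eq_empty_of_forall_notMem ?_
            rintro z ⟨hz, rfl⟩
            exact hik ((hpart _).unique hz hxy)
        | succ j =>
          simp_rw [mem_cayleyRelations_succ, ncard_cayley_triangles]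
          cases k using Fin.cases with
          | zero =>
            refine ⟨{u | u ∈ D i ∧ 0 - u ∈ D j}.ncard, fun x y hxy => ?_⟩
            rw [mem_cayleyRelations_zero] at hxy
            rw [hxy, sub_self]
          | succ k =>
            obtain ⟨n, hn⟩ := h.count i j k
            exact ⟨n, fun x y hxy => hn _ hxy⟩

theorem fuse_cayleyRelations {d' : ℕ} (D : Fin d → Set G) (Λ : Fin (d' + 1) → Set (Fin (d + 1)))
    (h0 : Λ 0 = {0}) (hΛ : ∀ j : Fin d', 0 ∉ Λ j.succ) :
    fuse (cayleyRelations D) Λ =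
      cayleyRelations fun j : Fin d' => ⋃ i ∈ {i : Fin d | i.succ ∈ Λ j.succ}, D i := by
  funext j
  ext ⟨x, y⟩
  cases j using Fin.cases with
  | zero =>
    simp only [fuse, h0, Set.mem_singleton_iff, Set.iUnion_iUnion_eq_left]
    rfl
  | succ j =>
    simp only [fuse, Set.mem_iUnion, exists_prop, mem_cayleyRelations_succ, Set.mem_ofPred_eq]
    constructor
    · rintro ⟨k, hk, hxy⟩
      cases k using Fin.cases with
      | zero => exact absurd hk (hΛ j)
      | succ k => exact ⟨k, hk, hxy⟩
    · rintro ⟨k, hk, hxy⟩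
      exact ⟨k.succ, hk, hxy⟩

theorem isAmorphic_cayleyRelations_iff [Finite G] (D : Fin d → Set G) :
    IsAmorphic (cayleyRelations D) ↔ IsTranslationScheme D ∧
      ∀ (d' : ℕ) (Λ : Fin d' → Set (Fin d)), IsPartitionFamily Λ →
        IsTranslationScheme fun j => ⋃ i ∈ Λ j, D i := by
  rw [IsAmorphic, isAssociationScheme_cayleyRelations_iff]
  refine and_congr_right fun _ => ⟨fun h d' Λ hΛ => ?_, fun h d' Λ hΛ h0 => ?_⟩
  · let Λ' : Fin (d' + 1) → Set (Fin (d + 1)) := Fin.cons {0} fun j => Fin.succ '' Λ j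
    have h1 : ∀ (i : Fin d) (j : Fin d'), i.succ ∈ Λ' j.succ ↔ i ∈ Λ j := fun i j => by
      simp [Λ']
    have h2 : ∀ j : Fin d', (0 : Fin (d + 1)) ∉ Λ' j.succ := fun j => by
      simp [Λ']
    have := h d' Λ' ⟨fun j => ?_, fun i => ?_⟩ rfl
    · rw [fuse_cayleyRelations D Λ' rfl h2, isAssociationScheme_cayleyRelations_iff] at this
      simpa only [h1, Set.ofPred_mem_eq] using this
    · cases j using Fin.cases with
      | zero => exact ⟨0, rfl⟩
      | succ j => exact (hΛ.1 j).image _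
    · cases i using Fin.cases with
      | zero =>
        refine ⟨0, rfl, fun j hj => ?_⟩
        cases j using Fin.cases with
        | zero => rfl
        | succ j => exact absurd hj (h2 j)
      | succ i =>
        obtain ⟨j, hj, huniq⟩ := hΛ.2 i
        refine ⟨j.succ, (h1 i j).mpr hj, fun k hk => ?_⟩
        cases k using Fin.cases with
        | zero => exact absurd hk (Fin.succ_ne_zero i)
        | succ k => exact congrArg _ (huniq k ((h1 i k).mp hk))
  · have h2 : ∀ j : Fin d', (0 : Fin (d + 1)) ∉ Λ j.succ := fun j hj =>
      Fin.succ_ne_zero j ((hΛ.2 0).unique hj (by rw [h0]; rfl))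
    rw [fuse_cayleyRelations D Λ h0 h2, isAssociationScheme_cayleyRelations_iff]
    refine h d' _ ⟨fun j => ?_, fun i => ?_⟩
    · obtain ⟨i, hi⟩ := hΛ.1 j.succ
      cases i using Fin.cases with
      | zero => exact absurd hi (h2 j)
      | succ i => exact ⟨i, hi⟩
    · obtain ⟨j, hj, huniq⟩ := hΛ.2 i.succ
      cases j using Fin.cases with
      | zero =>
        rw [h0] at hj
        exact absurd hj (Fin.succ_ne_zero i)
      | succ j => exact ⟨j, hj, fun k hk => Fin.succ_injective _ (huniq _ hk)⟩

end Cayley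

/-! ### Transfer between root sums and translation schemes -/

section RootSumScheme

open QuadraticMap

variable {K : Type*} [Field K]

/-- Deleting 0 from both sets affects only u = 0 and u = w; the corrections depend only on which
sets contain 0 and Q(w). -/
theorem ncard_nonzero_pairs {V : Type*} [AddCommGroup V] [Module K V] [Finite V]
    (Q : QuadraticForm K V) (S T : Set K) {w : V} (hw : w ≠ 0) :
    ({u | u ∈ quadricSet Q S \ {0} ∧ w - u ∈ quadricSet Q T \ {0}}.ncard : ℤ) =
      {u | Q u ∈ S ∧ Q (w - u) ∈ T}.ncard - S.indicator 1 0 * T.indicator 1 (Q w) -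
        S.indicator 1 (Q w) * T.indicator 1 0 := by
  classical
  have := Fintype.ofFinite V
  have h : ∀ u, {u | u ∈ quadricSet Q S \ {0} ∧ w - u ∈ quadricSet Q T \ {0}}.indicator
      (1 : V → ℤ) u = {u | Q u ∈ S ∧ Q (w - u) ∈ T}.indicator 1 u -
        (if u = 0 then S.indicator 1 0 * T.indicator 1 (Q w) else 0) -
        (if u = w then S.indicator 1 (Q w) * T.indicator 1 0 else 0) := by
    intro u
    by_cases h0 : u = 0
    · subst h0
      by_cases h1 : 0 ∈ S <;> by_cases h2 : Q w ∈ T <;> simp [h1, h2, hw.symm]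
    · by_cases h1 : u = w
      · subst h1
        by_cases h2 : Q u ∈ S <;> by_cases h3 : 0 ∈ T <;> simp [h2, h3, hw]
      · simp [h0, h1, quadricSet, Set.indicator_apply, sub_eq_zero, Ne.symm h1]
  rw [Set.ncard_eq_sum_indicator, Set.ncard_eq_sum_indicator, Finset.sum_congr rfl fun u _ => h u]
  simp [Finset.sum_sub_distrib]

theorem cons_quadricSet_eq {V : Type*} [AddCommGroup V] [Module K V] (Q : QuadraticForm K V)
    {d : ℕ} {T : Fin d → Set K} (hT : ∀ i, 0 ∉ T i) :
    (Fin.cons (quadricSet Q {0} \ {0}) fun i => quadricSet Q (T i) : Fin (d + 1) → Set V) =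
      fun i => quadricSet Q ((Fin.cons {0} T : Fin (d + 1) → Set K) i) \ {0} := by
  funext i
  cases i using Fin.cases with
  | zero => rfl
  | succ i =>
    refine (Set.sdiff_singleton_eq_self fun h => hT i ?_).symm
    rw [← map_zero Q]
    exact h

theorem existsUnique_mem_cons {d : ℕ} {T : Fin d → Set K} (hT0 : ∀ i, 0 ∉ T i)
    (hT : ∀ a, a ≠ 0 → ∃! i, a ∈ T i) (a : K) :
    ∃! i, a ∈ (Fin.cons {0} T : Fin (d + 1) → Set K) i := by
  by_cases ha : a = 0
  · refine ⟨0, ha, fun j hj => ?_⟩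
    cases j using Fin.cases with
    | zero => rfl
    | succ j => exact absurd (ha ▸ hj) (hT0 j)
  · obtain ⟨i, hi, huniq⟩ := hT a ha
    refine ⟨i.succ, hi, fun j hj => ?_⟩
    cases j using Fin.cases with
    | zero => exact absurd hj ha
    | succ j => exact congrArg _ (huniq j hj)

variable [Fintype K]

/-- The pair counts are affine in the root sums, and the corrections for deleting 0 are constant on
each class. The values need to be partitioned only as far as nonzero vectors attain them, which
covers the anisotropic case. -/
theorem isTranslationScheme_of_rootSum {V : Type*} [AddCommGroup V] [Module K V]
    [FiniteDimensional K V] {Q : QuadraticForm K V} {P E : ℤ} (hQ : HasValueCounts Q P E)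
    (hB : ∀ w, (∀ v, polar Q w v = 0) → w = 0) {c : ℕ} (U : Fin c → Set K)
    (hne : ∀ i, (quadricSet Q (U i) \ {0}).Nonempty) (huniq : ∀ w, w ≠ 0 → ∃! i, Q w ∈ U i)
    (hU : ∀ i j k, ∃ n : ℤ, ∀ t ∈ U k, rootSum ((U i).indicator 1) ((U j).indicator 1) t = n) :
    IsTranslationScheme fun i => quadricSet Q (U i) \ {0} := by
  have : Finite V := Module.finite_of_finite K
  have hq : (Nat.card K : ℤ) ≠ 0 := by exact_mod_cast Nat.card_pos.ne'
  refine ⟨hne, fun i h => h.2 rfl, fun x hx => ?_, fun i x hx => ?_, fun i j k => ?_⟩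
  · obtain ⟨i, hi, h⟩ := huniq x hx
    exact ⟨i, ⟨hi, hx⟩, fun j hj => h j hj.1⟩
  · refine ⟨?_, neg_ne_zero.mpr hx.2⟩
    change Q (-x) ∈ U i
    rw [QuadraticMap.map_neg]
    exact hx.1
  · obtain ⟨w₀, hw₀⟩ := hne k
    refine ⟨{u | u ∈ quadricSet Q (U i) \ {0} ∧ w₀ - u ∈ quadricSet Q (U j) \ {0}}.ncard,
      fun w hw => ?_⟩
    have hind : ∀ l, (U l).indicator (1 : K → ℤ) (Q w) = (U l).indicator 1 (Q w₀) := by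
      intro l
      have h1 : Q w ∈ U l ↔ l = k :=
        ⟨fun h => (huniq w hw.2).unique h hw.1, fun h => h ▸ hw.1⟩
      have h2 : Q w₀ ∈ U l ↔ l = k :=
        ⟨fun h => (huniq w₀ hw₀.2).unique h hw₀.1, fun h => h ▸ hw₀.1⟩
      classical
      simp [Set.indicator_apply, h1, h2]
    obtain ⟨n, hn⟩ := hU i j k
    have hK : (Nat.card K : ℤ) * (Nat.card K ^ (Module.finrank K V - 1) : ℕ) = Nat.card V := by
      have : Nontrivial V := ⟨w, 0, hw.2⟩
      rw [Module.natCard_eq_pow_finrank (K := K) (V := V), ← Nat.cast_mul, ← pow_succ',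
        Nat.sub_add_cancel Module.finrank_pos]
    have hpairs : ({u | Q u ∈ U i ∧ Q (w - u) ∈ U j}.ncard : ℤ) =
        {u | Q u ∈ U i ∧ Q (w₀ - u) ∈ U j}.ncard := by
      refine mul_left_cancel₀ hq ?_
      rw [hQ.card_mul_ncard_pairs hB hK hw.2, hQ.card_mul_ncard_pairs hB hK hw₀.2,
        hn _ hw.1, hn _ hw₀.1]
    have := ncard_nonzero_pairs Q (U i) (U j) hw.2
    rw [hpairs, hind, hind, ← ncard_nonzero_pairs Q (U i) (U j) hw₀.2] at this
    exact_mod_cast this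

/-- A partition of the nonzero elements of a finite field such that the sums of `rootCount` over
pairs of its parts are constant on its parts. -/
structure IsRootScheme {d : ℕ} (T : Fin d → Set K) : Prop where
  nonempty : ∀ i, (T i).Nonempty
  zero_notMem : ∀ i, 0 ∉ T i
  exists_unique : ∀ a, a ≠ 0 → ∃! i, a ∈ T i
  const : ∀ i j k, ∃ n : ℤ, ∀ t ∈ T k, rootSum ((T i).indicator 1) ((T j).indicator 1) t = n

/-- For the norm form the affine relation has coefficient -1, so root sums can be recovered from
intersection numbers; surjectivity of the norm reaches every value. -/
theorem IsTranslationScheme.isRootScheme {L : Type*} [Field L] [Algebra K L]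
    (hL : Module.finrank K L = 2) {d : ℕ} {T : Fin d → Set K}
    (h : IsTranslationScheme fun i => quadricSet (normForm K L hL) (T i)) : IsRootScheme T := by
  have := finite_of_finrank_eq_two hL
  have hsurj : ∀ a : K, ∃ x, normForm K L hL x = a := FiniteField.norm_surjective K L
  refine ⟨fun i => ?_, fun i hi => h.zero_notMem i ?_, fun a ha => ?_, fun i j k => ?_⟩
  · obtain ⟨x, hx⟩ := h.nonempty i
    exact ⟨_, hx⟩
  · change normForm K L hL 0 ∈ T i
    rwa [map_zero]
  · obtain ⟨x, rfl⟩ := hsurj a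
    exact h.exists_unique x fun hx => ha (by rw [hx, map_zero])
  · obtain ⟨n, hn⟩ := h.count i j k
    refine ⟨(T i).ncard * (T j).ncard - n, fun t ht => ?_⟩
    obtain ⟨x, rfl⟩ := hsurj t
    have hx : x ≠ 0 := fun hx => h.zero_notMem k (hx ▸ ht)
    have := ncard_normForm_pairs hL hx (T i) (T j)
    rw [← hn x ht]
    change _ = _ - (({u | normForm K L hL u ∈ T i ∧ normForm K L hL (x - u) ∈ T j}.ncard : ℕ) : ℤ)
    rw [this]
    ring

variable {V : Type*} [AddCommGroup V] [Module K V] [FiniteDimensional K V]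

theorem HasValueCounts.surjective_of_nondegenerate {Q : QuadraticForm K V} {P E : ℤ}
    (hQ : HasValueCounts Q P E) (hB : ∀ w, (∀ v, polar Q w v = 0) → w = 0) [Nontrivial V]
    {a : K} (ha : a ≠ 0) : ∃ v, Q v = a := by
  have : Finite V := Module.finite_of_finite K
  by_contra! hne
  have hP : P = 0 := by
    have := hQ a
    rw [Set.indicator_of_notMem (by simpa using ha), show Q ⁻¹' {a} = ∅ from
      Set.eq_empty_of_forall_notMem hne] at this
    simpa using this.symm
  have h0 : ∀ v, Q v = 0 := by
    intro v
    by_contra hv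
    have := hQ (Q v)
    rw [Set.indicator_of_notMem (by simpa using hv), hP] at this
    have h1 : (Q ⁻¹' {Q v}).ncard = 0 := by exact_mod_cast this
    rw [Set.ncard_eq_zero] at h1
    exact Set.notMem_empty v (h1 ▸ rfl)
  obtain ⟨w, hw⟩ := exists_ne (0 : V)
  exact hw (hB w fun v => by simp [polar, h0])

variable {Q : QuadraticForm K V} {P E : ℤ} {d : ℕ} {T : Fin d → Set K}

theorem IsRootScheme.isTranslationScheme_of_anisotropic [Nontrivial V] (hT : IsRootScheme T)
    (hQ : HasValueCounts Q P E) (hB : ∀ w, (∀ v, polar Q w v = 0) → w = 0)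
    (hani : Q.Anisotropic) : IsTranslationScheme fun i => quadricSet Q (T i) := by
  have hdiff : ∀ i, quadricSet Q (T i) \ {0} = quadricSet Q (T i) := fun i =>
    Set.sdiff_singleton_eq_self fun h : Q 0 ∈ T i => hT.zero_notMem i (by rwa [map_zero] at h)
  have h := isTranslationScheme_of_rootSum hQ hB T (fun i => ?_)
    (fun w hw => hT.exists_unique _ fun h => hw (hani w h)) hT.const
  · simpa only [hdiff] using h
  rw [hdiff]
  obtain ⟨a, ha⟩ := hT.nonempty i
  obtain ⟨v, rfl⟩ := hQ.surjective_of_nondegenerate hB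
    (fun h => hT.zero_notMem i (h ▸ ha) : a ≠ 0)
  exact ⟨v, ha⟩

theorem quadricSet_cons_nonempty [Nontrivial V] (hT : IsRootScheme T)
    (hQ : HasValueCounts Q P E) (hB : ∀ w, (∀ v, polar Q w v = 0) → w = 0)
    (hani : ¬ Q.Anisotropic) (i : Fin (d + 1)) :
    (quadricSet Q ((Fin.cons {0} T : Fin (d + 1) → Set K) i) \ {0}).Nonempty := by
  cases i using Fin.cases with
  | zero =>
    obtain ⟨x, hx, hx0⟩ := (not_anisotropic_iff_exists Q).mp hani
    exact ⟨x, hx0, hx⟩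
  | succ i =>
    obtain ⟨a, ha⟩ := hT.nonempty i
    have ha0 : a ≠ 0 := fun h => hT.zero_notMem i (h ▸ ha)
    obtain ⟨v, rfl⟩ := hQ.surjective_of_nondegenerate hB ha0
    exact ⟨v, ha, fun h => ha0 (by rw [Set.mem_singleton_iff.mp h, map_zero])⟩

/-- The sums not involving {0} are constant by hypothesis. Those with {0} equal |S| - [t ∈ S] for t
≠ 0, and the class of the single value t = 0 needs no argument. -/
theorem IsRootScheme.isTranslationScheme_of_isotropic [Nontrivial V] (hT : IsRootScheme T)
    (hQ : HasValueCounts Q P E) (hB : ∀ w, (∀ v, polar Q w v = 0) → w = 0)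
    (hani : ¬ Q.Anisotropic) :
    IsTranslationScheme (Fin.cons (quadricSet Q {0} \ {0}) fun i => quadricSet Q (T i) :
      Fin (d + 1) → Set V) := by
  rw [cons_quadricSet_eq Q hT.zero_notMem]
  refine isTranslationScheme_of_rootSum hQ hB _ (quadricSet_cons_nonempty hT hQ hB hani)
    (fun w _ => existsUnique_mem_cons hT.zero_notMem hT.exists_unique (Q w)) fun i j k => ?_
  have hzero : ∀ (S : Set K) (k : Fin d), ∃ n : ℤ, (∃ l, S = (Fin.cons {0} T : Fin (d + 1) → Set K) l) →
      ∀ t ∈ T k, rootSum (Set.indicator {0} 1) (S.indicator 1) t = n := by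
    classical
    intro S k
    by_cases hS : S = T k
    · refine ⟨S.ncard - 1, fun _ t ht => ?_⟩
      rw [rootSum_zero_singleton_of_ne S fun h => hT.zero_notMem k (h ▸ ht)]
      simp [hS, ht]
    · refine ⟨S.ncard, fun ⟨l, hl⟩ t ht => ?_⟩
      rw [rootSum_zero_singleton_of_ne S fun h => hT.zero_notMem k (h ▸ ht),
        Set.indicator_of_notMem, sub_zero]
      intro htS
      rw [hl] at htS
      have := (existsUnique_mem_cons hT.zero_notMem hT.exists_unique t).unique htS
        (show t ∈ (Fin.cons {0} T : Fin (d + 1) → Set K) k.succ from ht)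
      rw [hl, this] at hS
      exact hS rfl
  cases k using Fin.cases with
  | zero => exact ⟨_, fun t ht => by rw [Set.mem_singleton_iff.mp ht]⟩
  | succ k =>
    cases i using Fin.cases with
    | zero =>
      obtain ⟨n, hn⟩ := hzero ((Fin.cons {0} T : Fin (d + 1) → Set K) j) k
      exact ⟨n, hn ⟨j, rfl⟩⟩
    | succ i =>
      cases j using Fin.cases with
      | zero =>
        obtain ⟨n, hn⟩ := hzero (T i) k
        refine ⟨n, fun t ht => ?_⟩
        rw [rootSum_comm]
        exact hn ⟨i.succ, rfl⟩ t ht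
      | succ j => exact hT.const i j k

/-- If the sum of `rootCount` over every union `S` of parts of a partition is constant on `S` and on
its complement, then the sums over pairs of parts of any coarser partition are constant on parts. -/
theorem rootSum_const_of_fusions {c n : ℕ} (T : Fin n → Set K) (hT : ∀ a, ∃! i, a ∈ T i)
    (h : ∀ J : Set (Fin n), ∃ x y : ℤ, ∀ t,
      rootSum ((⋃ i ∈ J, T i).indicator 1) ((⋃ i ∈ J, T i).indicator 1) t =
        x + y * (⋃ i ∈ J, T i).indicator 1 t)
    (Λ : Fin c → Set (Fin n)) (hΛ : IsPartitionFamily Λ) (i j k : Fin c) :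
    ∃ m : ℤ, ∀ t ∈ ⋃ l ∈ Λ k, T l,
      rootSum ((⋃ l ∈ Λ i, T l).indicator 1) ((⋃ l ∈ Λ j, T l).indicator 1) t = m := by
  classical
  have hmem : ∀ t ∈ ⋃ l ∈ Λ k, T l, ∀ i, t ∈ ⋃ l ∈ Λ i, T l ↔ i = k := by
    intro t ht i
    refine ⟨fun hi => ?_, fun h => h ▸ ht⟩
    simp only [Set.mem_iUnion, exists_prop] at ht hi
    obtain ⟨a, ha, hta⟩ := ht
    obtain ⟨b, hb, htb⟩ := hi
    rw [(hT t).unique htb hta] at hb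
    exact (hΛ.2 a).unique hb ha
  by_cases hij : i = j
  · subst hij
    obtain ⟨x, y, hxy⟩ := h (Λ i)
    refine ⟨x + y * if i = k then 1 else 0, fun t ht => ?_⟩
    rw [hxy, Set.indicator_apply]
    simp only [hmem t ht, Pi.one_apply]
  · obtain ⟨x, y, hxy⟩ := h (Λ i)
    obtain ⟨x', y', hxy'⟩ := h (Λ j)
    obtain ⟨x'', y'', hxy''⟩ := h (Λ i ∪ Λ j)
    have hdisj : Disjoint (⋃ l ∈ Λ i, T l) (⋃ l ∈ Λ j, T l) := by
      rw [Set.disjoint_left]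
      intro t hi hj
      simp only [Set.mem_iUnion, exists_prop] at hi hj
      obtain ⟨a, ha, hta⟩ := hi
      obtain ⟨b, hb, htb⟩ := hj
      rw [(hT t).unique htb hta] at hb
      exact hij ((hΛ.2 a).unique ha hb)
    simp_rw [Set.biUnion_union, Set.indicator_union_of_disjoint hdisj] at hxy''
    have hadd : (fun a => (⋃ l ∈ Λ i, T l).indicator (1 : K → ℤ) a +
        (⋃ l ∈ Λ j, T l).indicator 1 a) = (⋃ l ∈ Λ i, T l).indicator 1 +
          (⋃ l ∈ Λ j, T l).indicator 1 := rfl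
    simp_rw [hadd, rootSum_add_left, rootSum_add_right, hxy, hxy',
      rootSum_comm ((⋃ l ∈ Λ j, T l).indicator 1)] at hxy''
    -- Polarization: expanding the sum for the union of two distinct parts leaves twice the mixed
    -- sum, so the integer division is exact.
    refine ⟨(x'' - x - x' + (y'' - y) * (if i = k then 1 else 0) +
      (y'' - y') * (if j = k then 1 else 0)) / 2, fun t ht => ?_⟩
    have h2 := hxy'' t
    simp only [Set.indicator_apply, hmem t ht, Pi.one_apply] at h2
    symm
    refine Int.ediv_eq_of_eq_mul_right two_ne_zero ?_
    linear_combination -h2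

end RootSumScheme

/-! ### Arithmetic of the two eigenvalues -/

section TwoValues

/-- If one value is a root of y(y - q), then subtracting q times the first moment from the second
shows that the other is too; the variance is nonzero, so they differ. -/
theorem two_values_of_value {q s s₁ s₂ y₁ y₂ : ℤ} (hq : 1 < q) (hs : 0 < s) (hs' : s < q - 1)
    (h : s₁ + s₂ = q - 1) (e₁ : s₁ * y₁ + s₂ * y₂ = q * s)
    (e₂ : s₁ * y₁ ^ 2 + s₂ * y₂ ^ 2 = q ^ 2 * s) (hy : y₂ = 0 ∨ y₂ = q) :
    y₁ = 0 ∧ y₂ = q ∨ y₁ = q ∧ y₂ = 0 := by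
  have hδ : (y₂ - y₁) ^ 2 * (s₁ * s₂) = q ^ 2 * (s * (q - 1 - s)) := by
    linear_combination (q - 1) * e₂ - (s₁ * y₁ + s₂ * y₂ + q * s) * e₁ +
      (s₁ * y₁ ^ 2 + s₂ * y₂ ^ 2) * h
  have hpos : 0 < q ^ 2 * (s * (q - 1 - s)) := by
    have : 0 < q - 1 - s := by linarith
    positivity
  rw [← hδ] at hpos
  have hs₁ : s₁ ≠ 0 := by rintro rfl; simp at hpos
  have hne : y₂ ≠ y₁ := by rintro rfl; simp at hpos
  have h1 : s₁ * (y₁ * (y₁ - q)) = 0 := by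
    have : s₂ * (y₂ * (y₂ - q)) = 0 := by rcases hy with rfl | rfl <;> ring
    linear_combination e₂ - q * e₁ - this
  rcases mul_eq_zero.mp ((mul_eq_zero.mp h1).resolve_left hs₁) with h0 | h0
  · exact Or.inl ⟨h0, hy.resolve_left fun h => hne (h.trans h0.symm)⟩
  · rw [sub_eq_zero] at h0
    exact Or.inr ⟨h0, hy.resolve_right fun h => hne (h.trans h0.symm)⟩

/-- The first moment becomes (q - 1)y₂ = q(s + σRc). Hence y₂ = qz with (q - 1)z = s + σRc, and 0 <
s < q - 1, 0 ≤ Rc < q - 1 leave only z = 0 or 1. -/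
theorem value_of_small_difference {q s s₁ s₂ y₁ y₂ σ A R c : ℤ} (hq : 1 < q) (hs : 0 < s)
    (hs' : s < q - 1) (hs₁ : 0 ≤ s₁) (hs₂ : 0 < s₂) (h : s₁ + s₂ = q - 1)
    (e₁ : s₁ * y₁ + s₂ * y₂ = q * s) (hσ : σ = 1 ∨ σ = -1) (hR : 1 ≤ R) (hA : A * R = q)
    (hδ : y₂ - y₁ = σ * A) (hc : s₁ = R * R * c) : y₂ = 0 ∨ y₂ = q := by
  obtain ⟨z, hz⟩ : ∃ z, y₂ = q * z := ⟨y₂ - s - σ * R * c, by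
    linear_combination -e₁ - s₁ * hδ + y₂ * h - σ * A * hc - σ * R * c * hA⟩
  have hz2 : (q - 1) * z = s + σ * (R * c) := by
    refine mul_left_cancel₀ (by linarith : q ≠ 0) ?_
    linear_combination e₁ + s₁ * hδ - y₂ * h + σ * A * hc + σ * R * c * hA - (q - 1) * hz
  have hc0 : 0 ≤ c := by
    by_contra! hneg
    nlinarith [mul_pos (by linarith : 0 < R) (by linarith : 0 < R)]
  have hRc0 : 0 ≤ R * c := by positivity
  have hRc : R * c < q - 1 := by nlinarith
  have hz0 : z = 0 ∨ z = 1 := by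
    have h1 : -1 < z := by
      by_contra! hneg
      rcases hσ with rfl | rfl <;> nlinarith
    have h2 : z < 2 := by
      by_contra! hneg
      rcases hσ with rfl | rfl <;> nlinarith
    omega
  rcases hz0 with rfl | rfl
  · exact Or.inl (by rw [hz, mul_zero])
  · exact Or.inr (by rw [hz, mul_one])

/-- Here the first moment gives y₂ = qRz with (q - 1)z = Rc + σs₁, and size again forces z = 0 or 1.
In the latter case σ = 1 and y₁ = y₂ - qR = 0. -/
theorem value_of_large_difference {q s s₁ s₂ y₁ y₂ σ A R c : ℤ} (hq : 1 < q) (hs : 0 < s)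
    (hs' : s < q - 1) (hs₁ : 0 < s₁) (hs₂ : 0 < s₂) (h : s₁ + s₂ = q - 1)
    (e₁ : s₁ * y₁ + s₂ * y₂ = q * s) (hσ : σ = 1 ∨ σ = -1) (hR : 1 ≤ R) (hA : A * R = q)
    (hδ : y₂ - y₁ = σ * (q * R)) (hc : s = R * R * c) : y₂ = 0 ∨ y₁ = 0 := by
  obtain ⟨x, hx⟩ : ∃ x, y₂ = q * x := ⟨y₂ - R * (R * c + σ * s₁), by
    linear_combination -e₁ - s₁ * hδ + y₂ * h - q * hc⟩
  have hx2 : (q - 1) * x = R * (R * c + σ * s₁) := by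
    refine mul_left_cancel₀ (by linarith : q ≠ 0) ?_
    linear_combination e₁ + s₁ * hδ - y₂ * h + q * hc - (q - 1) * hx
  obtain ⟨z, hz⟩ : ∃ z, x = R * z := ⟨A * x - (R * c + σ * s₁), by
    linear_combination -hx2 - x * hA⟩
  have hz2 : (q - 1) * z = R * c + σ * s₁ := by
    refine mul_left_cancel₀ (by linarith : R ≠ 0) ?_
    linear_combination hx2 - (q - 1) * hz
  have hc0 : 0 ≤ c := by
    by_contra! hneg
    nlinarith [mul_pos (by linarith : 0 < R) (by linarith : 0 < R)]
  have hRc0 : 0 ≤ R * c := by positivity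
  have hRc : R * c < q - 1 := by nlinarith
  have h1 : -1 < z := by
    by_contra! hneg
    rcases hσ with rfl | rfl <;> nlinarith
  have h2 : z < 2 := by
    by_contra! hneg
    rcases hσ with rfl | rfl <;> nlinarith
  rcases (by omega : z = 0 ∨ z = 1) with rfl | rfl
  · exact Or.inl (by rw [hx, hz]; ring)
  · rcases hσ with rfl | rfl
    · exact Or.inr (by linear_combination -hδ + hx + q * hz)
    · nlinarith

theorem prime_pow_dvd_or_dvd {p k a b : ℕ} (hp : p.Prime) (hab : ¬ p ∣ a + b)
    (h : p ^ k ∣ a * b) : p ^ k ∣ a ∨ p ^ k ∣ b := by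
  by_cases ha : p ∣ a
  · have hb : ¬ p ∣ b := fun hb => hab (Nat.dvd_add ha hb)
    exact Or.inl (((hp.coprime_iff_not_dvd.mpr hb).pow_left k).dvd_of_dvd_mul_right h)
  · exact Or.inr (((hp.coprime_iff_not_dvd.mpr ha).pow_left k).dvd_of_dvd_mul_left h)

/-- The moments give (y₂ - y₁)² s₁s₂ = q² ss' with y₂ - y₁ = ±p^j. Comparing powers of p, a square
R² divides s₁s₂ (if j ≤ f) or ss' (if j > f). Both s₁ + s₂ and s + s' equal q - 1, which is prime to
p, so R² divides a single factor. -/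
theorem two_values_eq {p f q : ℕ} (hp : p.Prime) (hf : f ≠ 0) (hqp : q = p ^ f)
    {s s' s₁ s₂ : ℕ} (hs : 0 < s) (hs' : 0 < s') (h : s + s' + 1 = q) (h' : s₁ + s₂ + 1 = q)
    {y₁ y₂ : ℤ} (e₁ : s₁ * y₁ + s₂ * y₂ = q * s)
    (e₂ : s₁ * y₁ ^ 2 + s₂ * y₂ ^ 2 = (q : ℤ) ^ 2 * s) (hd : y₂ - y₁ ∣ (q : ℤ) ^ 2) :
    y₁ = 0 ∧ y₂ = q ∨ y₁ = q ∧ y₂ = 0 := by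
  have hpq : p ∣ q := hqp ▸ dvd_pow_self p hf
  have hnd : ∀ a b : ℕ, a + b + 1 = q → ¬ p ∣ a + b := fun a b hab hdvd =>
    hp.one_lt.ne' (Nat.dvd_one.mp ((Nat.dvd_add_right hdvd).mp (hab ▸ hpq)))
  have hZ : (s : ℤ) + s' + 1 = q := by exact_mod_cast h
  have hZ' : (s₁ : ℤ) + s₂ + 1 = q := by exact_mod_cast h'
  have hsZ : (0 : ℤ) < s := by exact_mod_cast hs
  have hsZ' : (0 : ℤ) < s' := by exact_mod_cast hs'
  have hq1 : (1 : ℤ) < q := by linarith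
  have hδ : (y₂ - y₁) ^ 2 * (s₁ * s₂) = (q : ℤ) ^ 2 * (s * s') := by
    linear_combination ((q : ℤ) - 1) * e₂ - (s₁ * y₁ + s₂ * y₂ + q * s) * e₁ +
      (s₁ * y₁ ^ 2 + s₂ * y₂ ^ 2) * hZ' - (q : ℤ) ^ 2 * s * hZ
  have hpos : 0 < (q : ℤ) ^ 2 * (s * s') := by positivity
  rw [← hδ] at hpos
  have hs₁ : 0 < s₁ := Nat.pos_of_ne_zero (by rintro rfl; simp at hpos)
  have hs₂ : 0 < s₂ := Nat.pos_of_ne_zero (by rintro rfl; simp at hpos)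
  have hsZ₁ : (0 : ℤ) < s₁ := by exact_mod_cast hs₁
  have hsZ₂ : (0 : ℤ) < s₂ := by exact_mod_cast hs₂
  have hswap : (y₁ = 0 ∨ y₁ = q) ∨ (y₂ = 0 ∨ y₂ = q) → y₁ = 0 ∧ y₂ = q ∨ y₁ = q ∧ y₂ = 0 := by
    rintro (hy | hy)
    · exact (two_values_of_value (q := q) (s := s) (s₁ := s₂) (s₂ := s₁) (y₁ := y₂) (y₂ := y₁)
        hq1 hsZ (by linarith) (by linarith) (by linarith) (by linarith) hy).symm.imp
          And.symm And.symm
    · exact two_values_of_value (q := q) (s := s) (s₁ := s₁) (s₂ := s₂)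
        hq1 hsZ (by linarith) (by linarith) e₁ e₂ hy
  have hdN : (y₂ - y₁).natAbs ∣ p ^ (2 * f) := by
    have := Int.natAbs_dvd_natAbs.mpr hd
    rwa [Int.natAbs_pow, Int.natAbs_natCast, hqp, ← pow_mul, mul_comm] at this
  obtain ⟨j, hj, hjδ⟩ := (Nat.dvd_prime_pow hp).mp hdN
  obtain ⟨σ, hσ, hσδ⟩ : ∃ σ : ℤ, (σ = 1 ∨ σ = -1) ∧ y₂ - y₁ = σ * (p ^ j : ℕ) := by
    rcases Int.natAbs_eq (y₂ - y₁) with h0 | h0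
    · exact ⟨1, Or.inl rfl, by rw [← hjδ, one_mul, ← h0]⟩
    · exact ⟨-1, Or.inr rfl, by rw [← hjδ, neg_one_mul, ← h0]⟩
  have hσ2 : σ ^ 2 = 1 := by rcases hσ with rfl | rfl <;> norm_num
  have hσ' : -σ = 1 ∨ -σ = -1 := by rcases hσ with rfl | rfl <;> norm_num
  have hδN : (p ^ j) ^ 2 * (s₁ * s₂) = q ^ 2 * (s * s') := by
    rw [hσδ, mul_pow, hσ2, one_mul] at hδ
    exact_mod_cast hδ
  have hR : ∀ k, (1 : ℤ) ≤ (p ^ k : ℕ) := fun k => by exact_mod_cast Nat.one_le_pow _ _ hp.pos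
  rcases le_or_gt j f with hjf | hjf
  · obtain ⟨k, rfl⟩ := Nat.exists_eq_add_of_le hjf
    have hA : ((p ^ j : ℕ) : ℤ) * (p ^ k : ℕ) = q := by
      rw [hqp, pow_add]; push_cast; rfl
    have hdvd : p ^ (2 * k) ∣ s₁ * s₂ := by
      refine ⟨s * s', Nat.eq_of_mul_eq_mul_left (pow_pos (pow_pos hp.pos j) 2) ?_⟩
      rw [hδN, hqp]
      ring
    have hsq : ∀ c : ℕ, ((p ^ (2 * k) * c : ℕ) : ℤ) = (p ^ k : ℕ) * (p ^ k : ℕ) * c := fun c => by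
      rw [two_mul, pow_add]; push_cast; rfl
    rcases prime_pow_dvd_or_dvd hp (hnd _ _ h') hdvd with ⟨c, hc⟩ | ⟨c, hc⟩
    · exact hswap (Or.inr (value_of_small_difference (q := q) (s := s) (s₁ := s₁) (s₂ := s₂)
        (c := c) hq1 hsZ (by linarith) hsZ₁.le hsZ₂ (by linarith) e₁ hσ (hR k) hA hσδ
        (by rw [hc, hsq])))
    · exact hswap (Or.inl (value_of_small_difference (q := q) (s := s) (s₁ := s₂) (s₂ := s₁)
        (c := c) (y₁ := y₂) hq1 hsZ (by linarith) hsZ₂.le hsZ₁ (by linarith) (by linarith)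
        hσ' (hR k) hA (by linarith) (by rw [hc, hsq])))
  · obtain ⟨k, rfl⟩ := Nat.exists_eq_add_of_lt hjf
    obtain ⟨n, hn⟩ := Nat.exists_eq_add_of_le (by omega : k + 1 ≤ f)
    have hA : ((p ^ n : ℕ) : ℤ) * (p ^ (k + 1) : ℕ) = q := by
      rw [hqp, hn, pow_add]; push_cast; ring
    have hqR : ((p ^ (f + k + 1) : ℕ) : ℤ) = q * (p ^ (k + 1) : ℕ) := by
      rw [add_assoc, pow_add, hqp]; push_cast; rfl
    rw [hqR] at hσδ
    have hdvd : p ^ (2 * (k + 1)) ∣ s * s' := by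
      refine ⟨s₁ * s₂, Nat.eq_of_mul_eq_mul_left (pow_pos (by omega) 2 : 0 < q ^ 2) ?_⟩
      rw [← hδN, hqp]
      ring
    have hsq : ∀ c : ℕ, ((p ^ (2 * (k + 1)) * c : ℕ) : ℤ) =
        (p ^ (k + 1) : ℕ) * (p ^ (k + 1) : ℕ) * c := fun c => by
      rw [two_mul, pow_add]; push_cast; rfl
    rcases prime_pow_dvd_or_dvd hp (hnd _ _ h) hdvd with ⟨c, hc⟩ | ⟨c, hc⟩
    · rcases value_of_large_difference (q := q) (s := s) (s₁ := s₁) (s₂ := s₂) (c := c)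
        hq1 hsZ (by linarith) hsZ₁ hsZ₂ (by linarith) e₁ hσ (hR (k + 1)) hA hσδ
        (by rw [hc, hsq]) with h0 | h0
      · exact hswap (Or.inr (Or.inl h0))
      · exact hswap (Or.inl (Or.inl h0))
    -- Passing to the complement replaces s by s', each y by q - y, and reverses the sign.
    · rcases value_of_large_difference (q := q) (s := s') (s₁ := s₁) (s₂ := s₂) (c := c)
        (y₁ := q - y₁) (y₂ := q - y₂) (σ := -σ)
        hq1 hsZ' (by linarith) hsZ₁ hsZ₂ (by linarith)
        (by linear_combination -e₁ + (q : ℤ) * hZ' - q * hZ) hσ' (hR (k + 1)) hA (by linarith)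
        (by rw [hc, hsq]) with h0 | h0
      · exact hswap (Or.inr (Or.inr (by linarith)))
      · exact hswap (Or.inl (Or.inr (by linarith)))

end TwoValues

/-! ### Character sums over the quadratic extension -/

theorem Set.cast_ncard_eq_sum_indicator {X : Type*} [Fintype X] (S : Set X) :
    (S.ncard : ℂ) = ∑ x, S.indicator 1 x := by
  classical
  rw [Set.ncard_eq_toFinset_card']
  simp [Set.indicator_apply]

theorem exists_int_of_isIntegral_of_mul_eq {z : ℂ} (hz : IsIntegral ℤ z) {a b : ℤ} (ha : a ≠ 0)
    (h : a * z = b) : ∃ n : ℤ, z = n := by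
  have ha' : (a : ℂ) ≠ 0 := Int.cast_ne_zero.mpr ha
  have hz' : z = algebraMap ℚ ℂ (b / a) := by
    rw [eq_ratCast]
    push_cast
    rw [eq_div_iff ha', mul_comm, h]
  rw [hz'] at hz
  obtain ⟨n, hn⟩ := IsIntegrallyClosed.isIntegral_iff.mp
    ((isIntegral_algebraMap_iff (algebraMap ℚ ℂ).injective).mp hz)
  refine ⟨n, ?_⟩
  rw [hz', ← hn]
  simp

section CharSum

variable {L : Type*} [Field L] [Fintype L]

/-- The value at `b` of the Fourier transform of the indicator function of `D`. -/
noncomputable def charSum (ψ : AddChar L ℂ) (D : Set L) (b : L) : ℂ :=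
  ∑ x, D.indicator 1 x * ψ (x * b)

variable {ψ : AddChar L ℂ}

theorem charSum_zero (D : Set L) : charSum ψ D 0 = D.ncard := by
  simp [charSum, Set.cast_ncard_eq_sum_indicator]

theorem isIntegral_charSum (D : Set L) (b : L) : IsIntegral ℤ (charSum ψ D b) := by
  classical
  refine IsIntegral.sum _ fun x _ => IsIntegral.mul ?_ ?_
  · rw [Set.indicator_apply]
    split_ifs
    · exact isIntegral_one
    · exact isIntegral_zero
  · refine IsIntegral.of_pow (Fintype.card_pos (α := L)) ?_
    rw [← AddChar.map_nsmul_eq_pow, card_nsmul_eq_zero, AddChar.map_zero_eq_one]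
    exact isIntegral_one

theorem charSum_sq (D : Set L) (b : L) :
    charSum ψ D b ^ 2 = ∑ w, ({u | u ∈ D ∧ w - u ∈ D}.ncard : ℂ) * ψ (w * b) := by
  classical
  have h : ∀ u, ∑ y, (D.indicator 1 u * ψ (u * b)) * (D.indicator 1 y * ψ (y * b)) =
      ∑ w, {u | u ∈ D ∧ w - u ∈ D}.indicator 1 u * ψ (w * b) := by
    intro u
    rw [← Equiv.sum_comp (Equiv.subRight u)]
    refine Finset.sum_congr rfl fun w _ => ?_
    have : ψ (w * b) = ψ (u * b) * ψ ((w - u) * b) := by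
      rw [← AddChar.map_add_eq_mul]
      congr 1
      ring
    rw [this, Equiv.subRight_apply]
    by_cases h1 : u ∈ D <;> by_cases h2 : w - u ∈ D <;> simp [h1, h2]
  rw [sq, charSum, Finset.sum_mul_sum, Finset.sum_congr rfl fun u _ => h u, Finset.sum_comm]
  refine Finset.sum_congr rfl fun w _ => ?_
  rw [Set.cast_ncard_eq_sum_indicator, Finset.sum_mul]

variable (hψ : ψ.IsPrimitive)
include hψ

theorem sum_addChar_mul (b : L) :
    ∑ x, ψ (x * b) = Set.indicator {0} (fun _ => (Fintype.card L : ℂ)) b := by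
  classical
  rw [AddChar.sum_mulShift b hψ]
  by_cases hb : b = 0 <;> simp [hb]

theorem sum_charSum_mul (D : Set L) (x : L) :
    ∑ b, charSum ψ D b * ψ (b * -x) = Fintype.card L * D.indicator 1 x := by
  classical
  simp_rw [charSum, Finset.sum_mul]
  rw [Finset.sum_comm]
  have h : ∀ y, ∑ b, D.indicator 1 y * ψ (y * b) * ψ (b * -x) =
      D.indicator 1 y * Set.indicator {0} (fun _ => (Fintype.card L : ℂ)) (y - x) := by
    intro y
    rw [← sum_addChar_mul hψ, Finset.mul_sum]
    refine Finset.sum_congr rfl fun b _ => ?_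
    rw [mul_assoc, ← AddChar.map_add_eq_mul]
    congr 2
    ring
  rw [Finset.sum_congr rfl fun y _ => h y, Finset.sum_eq_single x]
  · simp [mul_comm]
  · intro y _ hy
    simp [sub_eq_zero, hy]
  · simp

theorem sum_charSum_sq (D : Set L) :
    ∑ b, charSum ψ D b ^ 2 = Fintype.card L * {u | u ∈ D ∧ 0 - u ∈ D}.ncard := by
  classical
  simp_rw [charSum_sq]
  rw [Finset.sum_comm, Finset.sum_eq_single 0]
  · simp
  · intro w _ hw
    rw [← Finset.mul_sum, Finset.sum_congr rfl fun b _ => by rw [mul_comm w b],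
      sum_addChar_mul hψ]
    simp [hw]
  · simp

end CharSum

/-- The quotient b/c has norm 1, so multiplication by it permutes the connection set. -/
theorem charSum_quadricSet_eq {K L : Type*} [Field K] [Fintype K] [Field L] [Fintype L]
    [Algebra K L] (hL : Module.finrank K L = 2) (ψ : AddChar L ℂ) (T : Set K) {b c : L}
    (h : normForm K L hL b = normForm K L hL c) :
    charSum ψ (quadricSet (normForm K L hL) T) b = charSum ψ (quadricSet (normForm K L hL) T) c := by
  classical
  by_cases hb : b = 0
  · have hc : c = 0 := normForm_anisotropic hL c (by rw [← h, hb, map_zero])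
    rw [hb, hc]
  · have hc : c ≠ 0 := fun hc => hb (normForm_anisotropic hL b (by rw [h, hc, map_zero]))
    have hbc : b / c ≠ 0 := div_ne_zero hb hc
    symm
    rw [charSum, charSum, ← Equiv.sum_comp (Equiv.mulRight₀ (b / c) hbc)]
    refine Finset.sum_congr rfl fun x _ => ?_
    have hN : normForm K L hL (x * (b / c)) = normForm K L hL x := by
      simp only [normForm_apply] at h ⊢
      have h1 : Algebra.norm K (b / c) = 1 := by
        refine mul_right_cancel₀ (Algebra.norm_ne_zero_iff.mpr hc) ?_
        rw [← map_mul, div_mul_cancel₀ _ hc, h, one_mul]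
      rw [map_mul, h1, mul_one]
    have hmem : x * (b / c) ∈ quadricSet (normForm K L hL) T ↔
        x ∈ quadricSet (normForm K L hL) T := by
      simp only [quadricSet, Set.mem_ofPred_eq, hN]
    have hx : x * (b / c) * c = x * b := by field_simp
    change Set.indicator _ 1 (x * (b / c)) * ψ (x * (b / c) * c) = _
    rw [hx, Set.indicator_apply, Set.indicator_apply]
    simp only [hmem, Pi.one_apply]

/-! ### Strongly regular norm graphs are of negative Latin square type -/

section KeyCount

variable {K L : Type*} [Field K] [Fintype K] [Field L] [Algebra K L]

/-- A strongly regular Cayley graph on a quadratic extension of a finite field of order `q`, whose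
connection set is the set of elements with norm in `T`, is of negative Latin square type. -/
theorem negativeLatinSquare_of_stronglyRegular (hL : Module.finrank K L = 2) {T : Set K}
    (h0 : 0 ∉ T) (hT : T.Nonempty) (hT' : ∃ a, a ≠ 0 ∧ a ∉ T) {l μ : ℤ}
    (hl : ∀ w, normForm K L hL w ∈ T → ({u | u ∈ quadricSet (normForm K L hL) T ∧
      w - u ∈ quadricSet (normForm K L hL) T}.ncard : ℤ) = l)
    (hμ : ∀ w, w ≠ 0 → normForm K L hL w ∉ T → ({u | u ∈ quadricSet (normForm K L hL) T ∧
      w - u ∈ quadricSet (normForm K L hL) T}.ncard : ℤ) = μ) :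
    μ = T.ncard ^ 2 + T.ncard ∧ l = T.ncard ^ 2 + 3 * T.ncard - Fintype.card K := by
  classical
  have := finite_of_finrank_eq_two hL
  have := Fintype.ofFinite L
  have hsurj : ∀ a : K, ∃ x, normForm K L hL x = a := FiniteField.norm_surjective K L
  obtain ⟨ψ, hψ⟩ : ∃ ψ : AddChar L ℂ, ψ.IsPrimitive :=
    ⟨_, AddChar.FiniteField.primitiveChar_to_Complex_isPrimitive L⟩
  obtain ⟨D, hD⟩ : ∃ D, D = quadricSet (normForm K L hL) T := ⟨_, rfl⟩
  obtain ⟨q, hq⟩ : ∃ q, q = Fintype.card K := ⟨_, rfl⟩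
  obtain ⟨s, hs⟩ : ∃ s, s = T.ncard := ⟨_, rfl⟩
  have hmem : ∀ x, x ∈ D ↔ normForm K L hL x ∈ T := fun x => by rw [hD]; rfl
  have hD0 : (0 : L) ∉ D := by rwa [hmem, map_zero]
  have hk : (D.ncard : ℂ) = (q + 1) * s := by
    have := ncard_preimage_normForm hL h0
    rw [← hD, ← hq, ← hs] at this
    exact_mod_cast this
  have hcardL : (Fintype.card L : ℂ) = q ^ 2 := by
    rw [← Nat.card_eq_fintype_card, natCard_of_finrank_eq_two hL, Nat.card_eq_fintype_card, ← hq]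
    push_cast
    rfl
  have hcnt0 : {u | u ∈ D ∧ 0 - u ∈ D}.ncard = D.ncard := by
    congr 1
    ext u
    rw [Set.mem_ofPred_eq, zero_sub, hmem, hmem, QuadraticMap.map_neg, and_self_iff]
  have hcnt : ∀ w, ({u | u ∈ D ∧ w - u ∈ D}.ncard : ℂ) =
      μ + (l - μ) * D.indicator 1 w + ((q + 1) * s - μ) * Set.indicator {0} 1 w := by
    intro w
    by_cases hw : w = 0
    · rw [hw, hcnt0, hk]
      simp [hD0]
    · by_cases hwD : w ∈ D
      · have := hl w ((hmem w).mp hwD)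
        rw [← hD] at this
        have h2 : ({u | u ∈ D ∧ w - u ∈ D}.ncard : ℂ) = l := by exact_mod_cast this
        simp [h2, hw, hwD]
      · have := hμ w hw (fun h => hwD ((hmem w).mpr h))
        rw [← hD] at this
        have h2 : ({u | u ∈ D ∧ w - u ∈ D}.ncard : ℂ) = μ := by exact_mod_cast this
        simp [h2, hw, hwD]
  obtain ⟨θ, hθ⟩ : ∃ θ, θ = charSum ψ D := ⟨_, rfl⟩
  -- Strong regularity in Fourier form: the nontrivial eigenvalues are roots of one quadratic, so
  -- only θ₁ and θ₂ = (l - μ) - θ₁ can occur.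
  have hquad : ∀ b, b ≠ 0 → θ b ^ 2 = ((q + 1) * s - μ) + (l - μ) * θ b := by
    intro b hb
    rw [hθ, charSum_sq]
    simp_rw [hcnt, add_mul, Finset.sum_add_distrib, mul_assoc, ← Finset.mul_sum]
    rw [sum_addChar_mul hψ, ← charSum]
    simp [hb, Set.indicator_apply]
    ring
  have hθ0 : θ 0 = (q + 1) * s := by rw [hθ, charSum_zero, hk]
  have hθN : ∀ b c, normForm K L hL b = normForm K L hL c → θ b = θ c := by
    intro b c h
    rw [hθ, hD]
    exact charSum_quadricSet_eq hL ψ T h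
  obtain ⟨θ₁, hθ₁⟩ : ∃ z, z = θ 1 := ⟨_, rfl⟩
  obtain ⟨θ₂, hθ₂⟩ : ∃ z, z = (l - μ) - θ₁ := ⟨_, rfl⟩
  have hprod : θ₁ * θ₂ = μ - (q + 1) * s := by
    have := hquad 1 one_ne_zero
    rw [← hθ₁] at this
    rw [hθ₂]
    linear_combination -this
  have hval : ∀ b, b ≠ 0 → θ b ≠ θ₁ → θ b = θ₂ := by
    intro b hb hne
    have h1 := hquad b hb
    have h2 := hquad 1 one_ne_zero
    rw [← hθ₁] at h2
    have h3 : (θ b - θ₁) * (θ b - θ₂) = 0 := by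
      rw [hθ₂]
      linear_combination h1 - h2
    exact sub_eq_zero.mp ((mul_eq_zero.mp h3).resolve_left (sub_ne_zero.mpr hne))
  -- The eigenvalue at b depends only on the norm of b, so its level sets are preimages of sets of
  -- norms and have sizes (q + 1)s₁ and (q + 1)s₂.
  let S₁ : Set K := {t | t ≠ 0 ∧ ∀ b, normForm K L hL b = t → θ b = θ₁}
  let S₂ : Set K := {t | t ≠ 0 ∧ ∀ b, normForm K L hL b = t → θ b ≠ θ₁}
  have hN0 : ∀ b, b ≠ 0 → normForm K L hL b ≠ 0 := fun b hb h => hb (normForm_anisotropic hL b h)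
  have hB₁ : ∀ b, b ∈ quadricSet (normForm K L hL) S₁ ↔ b ≠ 0 ∧ θ b = θ₁ := fun b =>
    ⟨fun h => ⟨fun hb => h.1 (by rw [hb, map_zero]), h.2 b rfl⟩,
      fun h => ⟨hN0 b h.1, fun c hc => (hθN c b hc).trans h.2⟩⟩
  have hB₂ : ∀ b, b ∈ quadricSet (normForm K L hL) S₂ ↔ b ≠ 0 ∧ θ b ≠ θ₁ := fun b =>
    ⟨fun h => ⟨fun hb => h.1 (by rw [hb, map_zero]), h.2 b rfl⟩,
      fun h => ⟨hN0 b h.1, fun c hc => by rw [hθN c b hc]; exact h.2⟩⟩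
  obtain ⟨s₁, hs₁⟩ : ∃ z, z = S₁.ncard := ⟨_, rfl⟩
  obtain ⟨s₂, hs₂⟩ : ∃ z, z = S₂.ncard := ⟨_, rfl⟩
  have hF : ∀ F : ℂ → ℂ, ∑ b, F (θ b) =
      F ((q + 1) * s) + (q + 1) * s₁ * F θ₁ + (q + 1) * s₂ * F θ₂ := by
    intro F
    have h1 : ∀ b, F (θ b) = (if b = 0 then F ((q + 1) * s) else 0) +
        (quadricSet (normForm K L hL) S₁).indicator 1 b * F θ₁ +
        (quadricSet (normForm K L hL) S₂).indicator 1 b * F θ₂ := by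
      intro b
      simp only [Set.indicator_apply, hB₁, hB₂]
      by_cases hb : b = 0
      · simp [hb, hθ0]
      · by_cases hb1 : θ b = θ₁
        · simp [hb, hb1]
        · rw [if_neg hb, if_neg fun h => hb1 h.2, if_pos ⟨hb, hb1⟩, hval b hb hb1]
          simp
    have h2 : ∀ S : Set K, 0 ∉ S → ((quadricSet (normForm K L hL) S).ncard : ℂ) =
        (q + 1) * S.ncard := by
      intro S hS
      have := ncard_preimage_normForm hL hS
      rw [← hq] at this
      exact_mod_cast this
    rw [Finset.sum_congr rfl fun b _ => h1 b, Finset.sum_add_distrib, Finset.sum_add_distrib,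
      ← Finset.sum_mul, ← Finset.sum_mul, ← Set.cast_ncard_eq_sum_indicator,
      ← Set.cast_ncard_eq_sum_indicator, h2 S₁ fun h => h.1 rfl, h2 S₂ fun h => h.1 rfl, ← hs₁,
      ← hs₂]
    simp
  have hq1 : (q : ℂ) + 1 ≠ 0 := by exact_mod_cast Nat.succ_ne_zero q
  have hcard : s₁ + s₂ + 1 = q := by
    have h1 := hF fun _ => 1
    rw [Finset.sum_const, Finset.card_univ, nsmul_one, hcardL] at h1
    have h2 : (s₁ : ℂ) + s₂ + 1 = q := by
      refine mul_left_cancel₀ hq1 ?_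
      linear_combination -h1
    exact_mod_cast h2
  have hlin : (s : ℂ) + s₁ * θ₁ + s₂ * θ₂ = 0 := by
    have h1 := hF id
    have h2 := sum_charSum_mul hψ D 0
    simp only [neg_zero, mul_zero, AddChar.map_zero_eq_one, mul_one, Set.indicator_of_notMem hD0,
      ← hθ] at h2
    simp only [id] at h1
    refine mul_left_cancel₀ hq1 ?_
    linear_combination h2 - h1
  have hsqs : ((q : ℂ) + 1) * s ^ 2 + s₁ * θ₁ ^ 2 + s₂ * θ₂ ^ 2 = q ^ 2 * s := by
    have h1 := hF fun z => z ^ 2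
    have h2 := sum_charSum_sq hψ D
    rw [hcnt0, hk, hcardL, ← hθ] at h2
    refine mul_left_cancel₀ hq1 ?_
    linear_combination h2 - h1
  have hsq : s + 2 ≤ q := by
    obtain ⟨a, ha, haT⟩ := hT'
    have h1 : insert 0 (insert a T) ⊆ Set.univ := Set.subset_univ _
    have h2 := Set.ncard_le_ncard h1
    rw [Set.ncard_insert_of_notMem (by simp [Ne.symm ha, h0]), Set.ncard_insert_of_notMem haT,
      Set.ncard_univ, Nat.card_eq_fintype_card, ← hq, ← hs] at h2
    exact h2
  have hs0 : 0 < s := by rw [hs]; exact hT.ncard_pos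
  have hcardC : (s₁ : ℂ) + s₂ + 1 = q := by exact_mod_cast hcard
  rw [← hs, ← hq]
  -- With equal multiplicities the first moment reads s = s₁(μ - l) with 0 < s < 2s₁ = q - 1, so μ -
  -- l = 1 and q = 2s + 1; the second moment then gives μ. Irrational eigenvalues are not excluded
  -- here.
  by_cases hss : s₁ = s₂
  · have h1 : (s : ℤ) + s₁ * (l - μ) = 0 := by
      have : (s : ℂ) + s₁ * (l - μ) = 0 := by
        rw [← hlin, ← hss, hθ₂]
        ring
      exact_mod_cast this
    have h2 : l - μ = -1 := by
      have hs1 : (s : ℤ) < 2 * s₁ := by omega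
      have hs2 : (0 : ℤ) < s := by exact_mod_cast hs0
      by_contra hne
      rcases lt_or_gt_of_ne hne with hlt | hgt
      · nlinarith
      · nlinarith
    have h3 : s = s₁ := by
      rw [h2] at h1
      omega
    have h4 : ((q : ℂ) + 1) * s + θ₁ ^ 2 + θ₂ ^ 2 = q ^ 2 := by
      have : (s : ℂ) ≠ 0 := by exact_mod_cast hs0.ne'
      refine mul_left_cancel₀ this ?_
      rw [← hss, ← h3] at hsqs
      linear_combination hsqs
    have h5 : (q : ℂ) = 2 * s + 1 := by
      rw [← hcardC, ← hss, ← h3]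
      ring
    have h2C : (l : ℂ) - μ = -1 := by exact_mod_cast h2
    have h6 : (μ : ℂ) = s ^ 2 + s := by
      rw [hθ₂, h2C] at hprod h4
      rw [h5] at h4 hprod
      linear_combination -(1 / 2 : ℂ) * h4 - hprod
    have h7 : μ = s ^ 2 + s := by exact_mod_cast h6
    refine ⟨h7, ?_⟩
    have h8 : (q : ℤ) = 2 * s + 1 := by exact_mod_cast h5
    rw [h8]
    linear_combination h2 + h7
  -- With unequal multiplicities, the first moment and θ₁ + θ₂ = l - μ are independent, so θ₁ is
  -- rational; being an algebraic integer, it is an integer.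
  · obtain ⟨n₁, hn₁⟩ : ∃ n : ℤ, θ₁ = n := by
      refine exists_int_of_isIntegral_of_mul_eq (a := (s₁ : ℤ) - s₂)
        (b := -(s : ℤ) - s₂ * (l - μ)) ?_ (sub_ne_zero.mpr (by exact_mod_cast hss)) ?_
      · rw [hθ₁, hθ]
        exact isIntegral_charSum D 1
      · push_cast
        linear_combination hlin + (-s₂ : ℂ) * hθ₂
    obtain ⟨n₂, hn₂⟩ : ∃ n : ℤ, n = l - μ - n₁ := ⟨_, rfl⟩
    have hn₂' : θ₂ = n₂ := by
      rw [hθ₂, hn₁, hn₂]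
      push_cast
      ring
    -- Fourier inversion on the dual graph: comparing one x in D with one nonzero x outside writes
    -- q² as θ₁ - θ₂ times an algebraic integer.
    have hdual : ∀ x, x ≠ 0 → (q : ℂ) ^ 2 * D.indicator 1 x = ((q + 1) * s - θ₂) +
        (θ₁ - θ₂) * charSum ψ (quadricSet (normForm K L hL) S₁) (-x) := by
      intro x hx
      have h1 : ∀ b, θ b = θ₂ + (if b = 0 then (q + 1) * s - θ₂ else 0) +
          (θ₁ - θ₂) * (quadricSet (normForm K L hL) S₁).indicator 1 b := by
        intro b
        simp only [Set.indicator_apply, hB₁]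
        by_cases hb : b = 0
        · simp [hb, hθ0]
        · by_cases hb1 : θ b = θ₁
          · simp [hb, hb1]
          · rw [if_neg hb, if_neg fun h => hb1 h.2, hval b hb hb1]
            simp
      rw [← hcardL, ← sum_charSum_mul hψ D x, ← hθ, charSum]
      have h2 := sum_addChar_mul hψ (-x)
      rw [Set.indicator_of_notMem (by simpa using hx)] at h2
      simp_rw [h1, add_mul, Finset.sum_add_distrib, mul_assoc, ← Finset.mul_sum]
      rw [h2]
      simp
    have hdvd : n₁ - n₂ ∣ (q : ℤ) ^ 2 := by
      obtain ⟨a, ha⟩ := hT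
      obtain ⟨x, rfl⟩ := hsurj a
      obtain ⟨a', ha0, ha'⟩ := hT'
      obtain ⟨x', rfl⟩ := hsurj a'
      have h1 := hdual x fun h => h0 (by rwa [h, map_zero] at ha)
      have h2 := hdual x' fun h => ha0 (by rw [h, map_zero])
      rw [Set.indicator_of_mem ((hmem x).mpr ha), Pi.one_apply, mul_one, hn₁, hn₂'] at h1
      rw [Set.indicator_of_notMem (fun h => ha' ((hmem x').mp h)), mul_zero, hn₁, hn₂'] at h2
      have h3 : ((n₁ - n₂ : ℤ) : ℂ) * (charSum ψ (quadricSet (normForm K L hL) S₁) (-x) -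
          charSum ψ (quadricSet (normForm K L hL) S₁) (-x')) = ((q ^ 2 : ℤ) : ℂ) := by
        push_cast
        linear_combination h2 - h1
      have hne : n₁ - n₂ ≠ 0 := by
        rintro h
        rw [h, Int.cast_zero, zero_mul] at h3
        have : (q : ℤ) ^ 2 = 0 := by exact_mod_cast h3.symm
        have : q = 0 := by simpa using this
        omega
      obtain ⟨c, hc⟩ := exists_int_of_isIntegral_of_mul_eq
        ((isIntegral_charSum _ _).sub (isIntegral_charSum _ _)) hne h3
      rw [hc] at h3
      exact ⟨c, by exact_mod_cast h3.symm⟩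
    have hlinZ : (s : ℤ) + s₁ * n₁ + s₂ * n₂ = 0 := by
      rw [hn₁, hn₂'] at hlin
      exact_mod_cast hlin
    have hsqsZ : ((q : ℤ) + 1) * s ^ 2 + s₁ * n₁ ^ 2 + s₂ * n₂ ^ 2 = q ^ 2 * s := by
      rw [hn₁, hn₂'] at hsqs
      exact_mod_cast hsqs
    have hprodZ : n₁ * n₂ = μ - (q + 1) * s := by
      rw [hn₁, hn₂'] at hprod
      exact_mod_cast hprod
    have hcardZ : (s₁ : ℤ) + s₂ + 1 = q := by exact_mod_cast hcard
    obtain ⟨f, hp, hpf⟩ := FiniteField.card K (ringChar K)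
    -- The shift y = s - θ turns the moments into qs and q²s, so the eigenvalues are s and s - q.
    have := two_values_eq (q := q) (s := s) (s' := q - 1 - s) (y₁ := s - n₁) (y₂ := s - n₂)
      hp f.ne_zero (hq.trans hpf) hs0 (by omega) (by omega) hcard
      (by linear_combination (s : ℤ) * hcardZ - hlinZ)
      (by linear_combination (s : ℤ) ^ 2 * hcardZ - 2 * s * hlinZ + hsqsZ)
      (by rwa [sub_sub_sub_cancel_left])
    rcases this with ⟨h1, h2⟩ | ⟨h1, h2⟩
    · have e1 : n₁ = s := by linarith
      have e2 : n₂ = s - q := by linarith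
      rw [e1, e2] at hprodZ
      rw [e1, e2] at hn₂
      constructor
      · linear_combination -hprodZ
      · linear_combination -hprodZ - hn₂
    · have e1 : n₁ = s - q := by linarith
      have e2 : n₂ = s := by linarith
      rw [e1, e2] at hprodZ
      rw [e1, e2] at hn₂
      constructor
      · linear_combination -hprodZ
      · linear_combination -hprodZ - hn₂

end KeyCount

/-! ### Root sums of fusions and amorphicity -/

section Fusion

variable {K L : Type*} [Field K] [Fintype K] [Field L] [Algebra K L]

theorem quadricSet_biUnion {K V : Type*} [Field K] [AddCommGroup V] [Module K V] (Q : QuadraticForm K V)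
    {ι : Type*} (T : ι → Set K) (I : Set ι) :
    ⋃ i ∈ I, quadricSet Q (T i) = quadricSet Q (⋃ i ∈ I, T i) := by
  ext x
  simp [quadricSet]

theorem rootSum_eq_of_normForm (hL : Module.finrank K L = 2) (T : Set K) {w : L} (hw : w ≠ 0) :
    rootSum (T.indicator 1) (T.indicator 1) (normForm K L hL w) = (T.ncard : ℤ) ^ 2 -
      {u | u ∈ quadricSet (normForm K L hL) T ∧ w - u ∈ quadricSet (normForm K L hL) T}.ncard := by
  have := ncard_normForm_pairs hL hw T T
  change _ = _ - (({u | normForm K L hL u ∈ T ∧ normForm K L hL (w - u) ∈ T}.ncard : ℕ) : ℤ)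
  rw [this]
  ring

theorem rootSum_nonzero_of_normForm (hL : Module.finrank K L = 2) {t : K} (ht : t ≠ 0) :
    rootSum (Set.indicator {0}ᶜ 1) (Set.indicator {0}ᶜ 1) t =
      -(({0}ᶜ : Set K).ncard : ℤ) + (Fintype.card K - 2 * ({0}ᶜ : Set K).ncard) := by
  have := finite_of_finrank_eq_two hL
  obtain ⟨w, rfl⟩ : ∃ w, normForm K L hL w = t := FiniteField.norm_surjective K L t
  have hw : w ≠ 0 := fun h => ht (by rw [h, map_zero])
  have hz : ∀ x, normForm K L hL x = 0 ↔ x = 0 := fun x =>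
    (normForm_anisotropic hL).eq_zero_iff
  have hset : {u | u ∈ quadricSet (normForm K L hL) {0}ᶜ ∧
      w - u ∈ quadricSet (normForm K L hL) {0}ᶜ} = {0, w}ᶜ := by
    ext u
    change (¬ normForm K L hL u = 0 ∧ ¬ normForm K L hL (w - u) = 0) ↔ ¬ (u = 0 ∨ u = w)
    rw [hz, hz, sub_eq_zero, not_or, eq_comm (a := w)]
  have h1 := Set.ncard_add_ncard_compl ({0, w} : Set L)
  rw [Set.ncard_pair hw.symm, natCard_of_finrank_eq_two hL] at h1
  have h2 := Set.ncard_add_ncard_compl ({0} : Set K)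
  rw [Set.ncard_singleton] at h2
  rw [rootSum_eq_of_normForm hL _ hw, hset, ← Nat.card_eq_fintype_card]
  zify at h1 h2
  rw [← h2] at h1 ⊢
  linear_combination -h1

variable {d : ℕ} {T : Fin d → Set K}

/-- The fusion into I and its complement is strongly regular, hence of negative Latin square type.
The cases t = 0, I empty and I full fall outside that argument but satisfy the same formula. -/
theorem rootSum_biUnion_of_fusions (hL : Module.finrank K L = 2) (hT : IsRootScheme T)
    (hfus : ∀ (d' : ℕ) (Λ : Fin d' → Set (Fin d)), IsPartitionFamily Λ →
      IsTranslationScheme fun j => ⋃ i ∈ Λ j, quadricSet (normForm K L hL) (T i))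
    (I : Set (Fin d)) (t : K) :
    rootSum ((⋃ i ∈ I, T i).indicator 1) ((⋃ i ∈ I, T i).indicator 1) t =
      -((⋃ i ∈ I, T i).ncard : ℤ) +
        (Fintype.card K - 2 * (⋃ i ∈ I, T i).ncard) * (⋃ i ∈ I, T i).indicator 1 t := by
  classical
  have := finite_of_finrank_eq_two hL
  have hT0 : (0 : K) ∉ ⋃ i ∈ I, T i := by
    simp only [Set.mem_iUnion, not_exists]
    exact fun i _ => hT.zero_notMem i
  by_cases ht : t = 0
  · rw [ht, rootSum_self_zero hT0, Set.indicator_of_notMem hT0]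
    simp
  rcases Set.eq_empty_or_nonempty I with rfl | hI
  · simp [rootSum]
  rcases Set.eq_empty_or_nonempty Iᶜ with hI' | hI'
  · have hU : ⋃ i ∈ I, T i = {0}ᶜ := by
      ext a
      rw [Set.compl_empty_iff.mp hI']
      simp only [Set.mem_univ, Set.iUnion_true, Set.mem_iUnion, Set.mem_compl_iff,
        Set.mem_singleton_iff]
      exact ⟨fun ⟨i, hi⟩ h => hT.zero_notMem i (h ▸ hi), fun h => (hT.exists_unique a h).exists⟩
    rw [hU, rootSum_nonzero_of_normForm hL ht, Set.indicator_of_mem (by simpa using ht)]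
    simp
  have hΛ : IsPartitionFamily ![I, Iᶜ] := by
    refine ⟨fun j => ?_, fun i => ?_⟩
    · fin_cases j
      · exact hI
      · exact hI'
    · by_cases hi : i ∈ I
      · refine ⟨0, hi, fun j hj => ?_⟩
        fin_cases j
        · rfl
        · exact absurd hi hj
      · refine ⟨1, hi, fun j hj => ?_⟩
        fin_cases j
        · exact absurd hj hi
        · rfl
  have h := hfus 2 _ hΛ
  simp_rw [quadricSet_biUnion] at h
  obtain ⟨l, hl⟩ := h.count 0 0 0
  obtain ⟨μ, hμ⟩ := h.count 0 0 1
  have hmem : ∀ a, a ≠ 0 → a ∉ ⋃ i ∈ I, T i → a ∈ ⋃ i ∈ Iᶜ, T i := by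
    intro a ha haI
    obtain ⟨i, hi⟩ := (hT.exists_unique a ha).exists
    simp only [Set.mem_iUnion, exists_prop] at haI ⊢
    exact ⟨i, fun hiI => haI ⟨i, hiI, hi⟩, hi⟩
  have hl' : ∀ w, normForm K L hL w ∈ ⋃ i ∈ I, T i →
      ({u | u ∈ quadricSet (normForm K L hL) (⋃ i ∈ I, T i) ∧
        w - u ∈ quadricSet (normForm K L hL) (⋃ i ∈ I, T i)}.ncard : ℤ) = l :=
    fun w hw => congrArg _ (hl w hw)
  have hμ' : ∀ w, w ≠ 0 → normForm K L hL w ∉ ⋃ i ∈ I, T i →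
      ({u | u ∈ quadricSet (normForm K L hL) (⋃ i ∈ I, T i) ∧
        w - u ∈ quadricSet (normForm K L hL) (⋃ i ∈ I, T i)}.ncard : ℤ) = μ :=
    fun w hw hwI => congrArg _
      (hμ w (hmem _ (fun h => hw (normForm_anisotropic hL w h)) hwI))
  have hne : ∀ J : Set (Fin d), J.Nonempty → (⋃ i ∈ J, T i).Nonempty := by
    rintro J ⟨i, hi⟩
    obtain ⟨a, ha⟩ := hT.nonempty i
    exact ⟨a, Set.mem_biUnion hi ha⟩
  have hne' : ∃ a, a ≠ 0 ∧ a ∉ ⋃ i ∈ I, T i := by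
    obtain ⟨i, hi⟩ := hI'
    obtain ⟨a, ha⟩ := hT.nonempty i
    have ha0 : a ≠ 0 := fun h => hT.zero_notMem i (h ▸ ha)
    refine ⟨a, ha0, fun haI => ?_⟩
    simp only [Set.mem_iUnion, exists_prop] at haI
    obtain ⟨j, hj, haj⟩ := haI
    exact hi ((hT.exists_unique a ha0).unique haj ha ▸ hj)
  obtain ⟨e₁, e₂⟩ := negativeLatinSquare_of_stronglyRegular hL hT0 (hne I hI) hne' hl' hμ'
  obtain ⟨w, rfl⟩ : ∃ w, normForm K L hL w = t := FiniteField.norm_surjective K L t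
  have hw : w ≠ 0 := fun h => ht (by rw [h, map_zero])
  rw [rootSum_eq_of_normForm hL _ hw]
  by_cases hwI : normForm K L hL w ∈ ⋃ i ∈ I, T i
  · rw [hl' w hwI, e₂, Set.indicator_of_mem hwI, Pi.one_apply]
    ring
  · rw [hμ' w hw hwI, e₁, Set.indicator_of_notMem hwI]
    ring

theorem biUnion_cons_eq {K : Type*} [Field K] {d : ℕ} (T : Fin d → Set K) (J : Set (Fin (d + 1))) :
    ⋃ i ∈ J, (Fin.cons {0} T : Fin (d + 1) → Set K) i =
      {x | x = 0 ∧ 0 ∈ J} ∪ ⋃ i ∈ {i : Fin d | i.succ ∈ J}, T i := by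
  ext x
  simp only [Set.mem_iUnion, exists_prop, Set.mem_union, Set.mem_ofPred_eq, Fin.exists_fin_succ,
    Fin.cons_zero, Fin.cons_succ, Set.mem_singleton_iff]
  rw [and_comm]

/-- Expanding for {0} ∪ S, the cross terms contribute 2|S| - 2[t ∈ S] for t ≠ 0. The resulting
formula also holds at t = 0, where the sum of {0} with itself is q - 1; hence 0 may join any part.
-/
theorem rootSum_biUnion_cons (hT : IsRootScheme T)
    (hsum : ∀ (I : Set (Fin d)) (t : K),
      rootSum ((⋃ i ∈ I, T i).indicator 1) ((⋃ i ∈ I, T i).indicator 1) t =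
        -((⋃ i ∈ I, T i).ncard : ℤ) +
          (Fintype.card K - 2 * (⋃ i ∈ I, T i).ncard) * (⋃ i ∈ I, T i).indicator 1 t)
    (J : Set (Fin (d + 1))) : ∃ x y : ℤ, ∀ t,
      rootSum ((⋃ i ∈ J, (Fin.cons {0} T : Fin (d + 1) → Set K) i).indicator 1)
        ((⋃ i ∈ J, (Fin.cons {0} T : Fin (d + 1) → Set K) i).indicator 1) t =
          x + y * (⋃ i ∈ J, (Fin.cons {0} T : Fin (d + 1) → Set K) i).indicator 1 t := by
  classical
  rw [biUnion_cons_eq]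
  obtain ⟨S, hS⟩ : ∃ S, S = ⋃ i ∈ {i : Fin d | i.succ ∈ J}, T i := ⟨_, rfl⟩
  have h := hsum {i : Fin d | i.succ ∈ J}
  have hS0 : (0 : K) ∉ S := by
    simp only [hS, Set.mem_iUnion, not_exists]
    exact fun i _ => hT.zero_notMem i
  rw [← hS] at h ⊢
  by_cases hJ : 0 ∈ J
  · have hset : {x : K | x = 0 ∧ 0 ∈ J} = {0} := by
      ext x
      simp [hJ]
    rw [hset]
    have hadd : (({0} : Set K) ∪ S).indicator (1 : K → ℤ) =
        Set.indicator {0} 1 + S.indicator 1 := by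
      rw [Set.indicator_union_of_disjoint (by simpa using hS0)]
      rfl
    refine ⟨1 + S.ncard, Fintype.card K - 2 - 2 * S.ncard, fun t => ?_⟩
    rw [hadd, rootSum_add_left, rootSum_add_right, rootSum_add_right, h,
      rootSum_comm (S.indicator 1)]
    by_cases ht : t = 0
    · rw [ht, rootSum_zero_singleton_zero hS0, rootSum_zero_zero_zero]
      simp [hS0]
      ring
    · rw [rootSum_zero_singleton_of_ne _ ht, rootSum_zero_singleton_of_ne _ ht]
      simp [ht]
      ring
  · have hset : {x : K | x = 0 ∧ 0 ∈ J} = ∅ := by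
      ext x
      simp [hJ]
    rw [hset, Set.empty_union]
    exact ⟨_, _, h⟩

variable {V : Type*} [AddCommGroup V] [Module K V] [FiniteDimensional K V] [Nontrivial V]
  {Q : QuadraticForm K V} {P E : ℤ}

theorem isTranslationScheme_fusion_of_isotropic (hL : Module.finrank K L = 2)
    (hT : IsRootScheme T)
    (hfus : ∀ (d' : ℕ) (Λ : Fin d' → Set (Fin d)), IsPartitionFamily Λ →
      IsTranslationScheme fun j => ⋃ i ∈ Λ j, quadricSet (normForm K L hL) (T i))
    (hQ : HasValueCounts Q P E) (hB : ∀ w, (∀ v, QuadraticMap.polar Q w v = 0) → w = 0)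
    (hani : ¬ Q.Anisotropic) {c : ℕ} (Λ : Fin c → Set (Fin (d + 1))) (hΛ : IsPartitionFamily Λ) :
    IsTranslationScheme fun j => ⋃ i ∈ Λ j,
      (Fin.cons (quadricSet Q {0} \ {0}) fun i => quadricSet Q (T i) :
        Fin (d + 1) → Set V) i := by
  have hex := existsUnique_mem_cons hT.zero_notMem hT.exists_unique
  have hU : (fun j => ⋃ i ∈ Λ j,
      (Fin.cons (quadricSet Q {0} \ {0}) fun i => quadricSet Q (T i) : Fin (d + 1) → Set V) i) =
      fun j => quadricSet Q (⋃ i ∈ Λ j, (Fin.cons {0} T : Fin (d + 1) → Set K) i) \ {0} := by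
    funext j
    rw [cons_quadricSet_eq Q hT.zero_notMem, ← quadricSet_biUnion]
    simp only [Set.iUnion_sdiff]
  rw [hU]
  refine isTranslationScheme_of_rootSum hQ hB _ (fun j => ?_) (fun w _ => ?_)
    (rootSum_const_of_fusions _ hex
      (rootSum_biUnion_cons hT (rootSum_biUnion_of_fusions hL hT hfus)) Λ hΛ)
  · obtain ⟨i, hi⟩ := hΛ.1 j
    obtain ⟨x, hx, hx0⟩ := quadricSet_cons_nonempty hT hQ hB hani i
    exact ⟨x, Set.mem_biUnion (t := fun i => (Fin.cons {0} T : Fin (d + 1) → Set K) i) hi hx, hx0⟩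
  · obtain ⟨i, hi, huniq⟩ := hex (Q w)
    obtain ⟨j, hj, huniq'⟩ := hΛ.2 i
    refine ⟨j, Set.mem_biUnion (t := fun i => (Fin.cons {0} T : Fin (d + 1) → Set K) i) hj hi,
      fun k hk => ?_⟩
    simp only [Set.mem_iUnion, exists_prop] at hk
    obtain ⟨i', hi', hw⟩ := hk
    rw [huniq i' hw] at hi'
    exact huniq' k hi'

end Fusion

/-! ### Cyclotomic classes as norm preimages, and the theorem -/

section Cyclotomic

variable {K L : Type*} [Field K] [Finite K] [Field L] [Algebra K L]

/-- The norm sends γ^k to ω^k. Since e divides the order of ω, the class of ω^k still determines k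
modulo e, and so the class of γ^k. -/
theorem cyclotomicUnion_eq_quadricSet (hL : Module.finrank K L = 2) (γ : Lˣ)
    (hγ : ∀ x : Lˣ, x ∈ Subgroup.zpowers γ) (ω : Kˣ)
    (hω : (ω : K) = Algebra.norm K (γ : L)) {e : ℕ} (he : e ∣ Nat.card K - 1) (A : Set (Fin e)) :
    cyclotomicUnion γ e A = quadricSet (normForm K L hL) (cyclotomicUnion ω e A) := by
  have := finite_of_finrank_eq_two hL
  have hNγ : Units.map (Algebra.norm K (S := L)) γ = ω := Units.ext hω.symm
  have hgen : ∀ x : Kˣ, x ∈ Subgroup.zpowers ω := by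
    intro x
    obtain ⟨y, rfl⟩ := FiniteField.unitsMap_norm_surjective K L x
    obtain ⟨j, rfl⟩ := Subgroup.mem_zpowers_iff.mp (hγ y)
    exact Subgroup.mem_zpowers_iff.mpr ⟨j, by rw [map_zpow, hNγ]⟩
  have hord : (e : ℤ) ∣ orderOf ω := by
    rw [orderOf_eq_card_of_forall_mem_zpowers hgen, Nat.card_units]
    exact_mod_cast he
  ext x
  simp only [cyclotomicUnion, cyclotomicClass, quadricSet, Set.mem_iUnion, Set.mem_ofPred_eq,
    exists_prop, normForm_apply]
  refine exists_congr fun l => and_congr_right fun _ => ?_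
  constructor
  · rintro ⟨u, hu, rfl⟩
    obtain ⟨j, rfl⟩ := Subgroup.mem_zpowers_iff.mp hu
    refine ⟨(ω ^ e) ^ j, Subgroup.zpow_mem_zpowers _ _, ?_⟩
    rw [← hNγ, ← map_pow, ← map_pow, ← map_zpow, ← map_mul]
    rfl
  · rintro ⟨u, hu, hx⟩
    obtain ⟨j, rfl⟩ := Subgroup.mem_zpowers_iff.mp hu
    have hx0 : x ≠ 0 := fun h => by
      rw [h, Algebra.norm_zero] at hx
      exact Units.ne_zero _ hx.symm
    obtain ⟨k, hk⟩ := Subgroup.mem_zpowers_iff.mp (hγ (Units.mk0 x hx0))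
    have h1 : ω ^ k = ω ^ (l : ℕ) * (ω ^ e) ^ j := by
      refine Units.ext ?_
      rw [← hx, ← hNγ, ← map_zpow, hk]
      rfl
    rw [← zpow_natCast ω e, ← zpow_mul, ← zpow_natCast ω (l : ℕ), ← zpow_add,
      zpow_eq_zpow_iff_modEq] at h1
    obtain ⟨r, hr⟩ := (h1.of_dvd hord).symm.dvd
    refine ⟨(γ ^ e) ^ (j + r), Subgroup.zpow_mem_zpowers _ _, ?_⟩
    have h2 : Units.mk0 x hx0 = γ ^ (l : ℕ) * (γ ^ e) ^ (j + r) := by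
      rw [← hk, ← zpow_natCast γ e, ← zpow_mul, ← zpow_natCast γ (l : ℕ), ← zpow_add]
      congr 1
      linear_combination hr
    rw [← h2, Units.val_mk0]

end Cyclotomic

theorem theorem5p2 {K L V : Type*} [Field K] [Finite K] [Field L] [Algebra K L]
    [AddCommGroup V] [Module K V]
    (hL : Module.finrank K L = 2)
    (γ : Lˣ) (hγ : ∀ x : Lˣ, x ∈ Subgroup.zpowers γ)
    (ω : Kˣ) (hω : (ω : K) = Algebra.norm K (γ : L))
    (m : ℕ) (hm : 0 < m) (hV : Module.finrank K V = 2 * m)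
    (Q : QuadraticForm K V) (hQ : Q.radical = ⊥)
    (e : ℕ) (he : e ∣ Nat.card K - 1)
    (d : ℕ) (A : Fin d → Set (Fin e)) (hA : IsPartitionFamily A)
    (hscheme : IsAssociationScheme (cayleyRelations fun i => cyclotomicUnion γ e (A i))) :
    (¬ Q.Anisotropic →
      IsAssociationScheme (cayleyRelations
        (Fin.cons (quadricSet Q {0} \ {0}) fun i => quadricSet Q (cyclotomicUnion ω e (A i)) :
          Fin (d + 1) → Set V)) ∧
      (IsAmorphic (cayleyRelations fun i => cyclotomicUnion γ e (A i)) →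
        IsAmorphic (cayleyRelations
          (Fin.cons (quadricSet Q {0} \ {0}) fun i => quadricSet Q (cyclotomicUnion ω e (A i)) :
            Fin (d + 1) → Set V)))) ∧
    (Q.Anisotropic →
      IsAssociationScheme (cayleyRelations fun i => quadricSet Q (cyclotomicUnion ω e (A i))) ∧
      (IsAmorphic (cayleyRelations fun i => cyclotomicUnion γ e (A i)) →
        IsAmorphic (cayleyRelations fun i => quadricSet Q (cyclotomicUnion ω e (A i))))) := by
  have := Fintype.ofFinite K
  have := finite_of_finrank_eq_two hL
  have : FiniteDimensional K V := Module.finite_of_finrank_pos (by omega)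
  have : Nontrivial V := Module.nontrivial_of_finrank_pos (R := K) (by omega)
  have : Finite V := Module.finite_of_finite K
  have hB := polar_nondegenerate_of_radical_eq_bot hV Q hQ
  obtain ⟨P, E, hval⟩ := exists_hasValueCounts hV Q hB
  simp_rw [cyclotomicUnion_eq_quadricSet hL γ hγ ω hω he] at hscheme ⊢
  rw [isAssociationScheme_cayleyRelations_iff] at hscheme
  have hT := hscheme.isRootScheme
  simp only [isAmorphic_cayleyRelations_iff, isAssociationScheme_cayleyRelations_iff]
  refine ⟨fun hani => ?_, fun hani => ?_⟩
  · have h1 := hT.isTranslationScheme_of_isotropic hval hB hani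
    exact ⟨h1, fun ham => ⟨h1, fun c Λ hΛ =>
      isTranslationScheme_fusion_of_isotropic hL hT ham.2 hval hB hani Λ hΛ⟩⟩
  · have h1 := hT.isTranslationScheme_of_anisotropic hval hB hani
    refine ⟨h1, fun ham => ⟨h1, fun c Λ hΛ => ?_⟩⟩
    -- Without the class of 0, a fusion of the new graphs comes from the same fusion of the
    -- cyclotomic scheme, so the transfer applies directly.
    have h2 := ham.2 c Λ hΛ
    simp only [quadricSet_biUnion] at h2 ⊢
    exact (h2.isRootScheme hL).isTranslationScheme_of_anisotropic hval hB hani
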